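/- Let $M$ be a connected smooth manifold of dimension $n > 2$ with a Riemannian metric $h$, Levi-Civita connection $D$ and curvature $\mathcal{R}_{ijk}{}^{l}$. Indices are raised and lowered with $h$; $[\,\cdot\,]$ and $(\,\cdot\,)$ denote (anti)symmetrization with weight one. The curvature of a torsion-free affine connection $\nabla$ is defined by $2\nabla_{[i}\nabla_{j]}X^{l} = R_{ijk}{}^{l}X^{k}$, its Ricci tensor is $R_{ij} = R_{pij}{}^{p}$ and its scalar trace is $R = h^{ij}R_{ij}$; for $D$ these are written $\mathcal{R}_{ij}$, $\mathcal{R}_{h}$. The covariant derivative of $\det h$, a section of $(\Lambda^{n}T^{*}M)^{\otimes 2}$, is the induced one. If $\nabla_{[i}h_{j]k}=0$ and $\nabla_{i}\det h = 0$, the connection conjugate to $\nabla$ is $\bar\nabla = \nabla + h^{kp}\nabla_{i}h_{jp}$, and $\nabla$ has self-conjugate curvature if $\nabla$ and $\bar\nabla$ have the same curvature tensor. For a smooth section $\omega_{ijk}$ of the bundle $S^{3}_{0}(T^{*}M)$ of completely symmetric trace-free $3$-tensors, let $|\omega|^{2} = \omega^{ijk}\omega_{ijk}$, let $\mathrm{div}(\omega)_{ij}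 = D^{p}\omega_{pij}$, let $$\mathcal{K}(\omega)_{ijkl} = D_{[i}\omega_{j]kl} - \tfrac{1}{n}\left(h_{k[i}\mathrm{div}(\omega)_{j]l} + h_{l[i}\mathrm{div}(\omega)_{j]k}\right)$$ be the trace-free part of $D_{[i}\omega_{j]kl}$, and let $\rho(\omega)_{ij} = (\omega\wedge\omega)_{pij}{}^{p}$, where $(\omega\wedge\omega)_{ijkl} = \omega_{k[i}{}^{p}\omega_{j]lp} - \omega_{l[i}{}^{p}\omega_{j]kp}$ (so $\rho(\omega)_{ij} = \omega_{i}{}^{pq}\omega_{jpq}$). For real constants $\kappa$ and $c$, the pair $(h,\omega)$ solves the coupled system with constants $\kappa$, $c$ if $$0 = -2n\,\omega^{pqr}\mathcal{K}(\omega)_{ipqr} + (n-2)\,\omega_{i}{}^{pq}\mathrm{div}(\omega)_{pq},$$ $$\mathcal{R}_{ij} - \tfrac12 \mathcal{R}_{h}h_{ij} + \tfrac{n-2}{2n}\kappa h_{ij} = c\left(\rho(\omega)_{ij} - \tfrac12|\omega|^{2}h_{ij}\right).$$ **Theorem.** (1) Suppose $\omega \in \Gamma(S^{3}_{0}(T^{*}M))$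 is Codazzi, meaning $D_{[i}\omega_{j]kl}=0$, and $(h,\omega)$ solves the coupled system for some $\kappa\in\mathbb{R}$ and $c = 1$. Then the smooth torsion-free affine connections $\nabla^{\pm} = D \pm \omega_{ij}{}^{k}$ have the following properties: (a) $\nabla^{\pm}_{[i}h_{j]k}=0$ and $\nabla^{\pm}_{i}\det h = 0$. (b) The curvatures of $\nabla^{+}$ and $\nabla^{-}$ agree: $R^{+}_{ijkl} = \mathcal{R}_{ijkl} + 2\omega_{pl[i}\omega_{j]k}{}^{p} = R^{-}_{ijkl}$, where $R^{\pm}_{ijkl} = R^{\pm}_{ijk}{}^{p}h_{pl}$. In particular this tensor has the symmetries of a metric curvature tensor: it is antisymmetric in $ij$ and in $kl$, and its antisymmetrization over $ijk$ vanishes. (c) $R^{\pm}_{ij} = \mathcal{R}_{ij} - \omega_{ip}{}^{q}\omega_{jq}{}^{p} = \tfrac{\kappa}{n}h_{ij}$, and $R^{\pm} = h^{ij}R^{\pm}_{ij} = \mathcal{R}_{h} - |\omega|^{2} = \kappa$ is constant. (2) Conversely, suppose $\nabla$ is a smooth torsion-free affine connection satisfying $\nabla_{[i}h_{j]k}=0$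 and $\nabla_{i}\det h=0$, having self-conjugate curvature, and satisfying $R_{ij} = \tfrac{\kappa}{n}h_{ij}$ for some constant $\kappa$. Then the difference tensor $\omega_{ij}{}^{k} = \nabla - D$ satisfies $\omega_{ijk} = \omega_{ij}{}^{p}h_{pk}\in\Gamma(S^{3}_{0}(T^{*}M))$ and $D_{[i}\omega_{j]kl}=0$, the function $\mathcal{R}_{h} - |\omega|^{2}$ is constant and equal to $\kappa$, and $(h,\omega)$ solves the coupled system with constants $\kappa$ and $c=1$. -/

import Mathlib

open Bundle Manifold ContDiff VectorField Module

noncomputable section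

namespace EinsteinCubic

variable {E : Type*} [NormedAddCommGroup E] [NormedSpace ℝ E] [FiniteDimensional ℝ E]
  {H : Type*} [TopologicalSpace H] {I : ModelWithCorners ℝ E H}
  {M : Type*} [TopologicalSpace M] [ChartedSpace H M] [IsManifold I ∞ M]

/-- A smooth Riemannian metric on `M`. -/
abbrev Metric (I : ModelWithCorners ℝ E H) (M : Type*) [TopologicalSpace M] [ChartedSpace H M]
    [IsManifold I ∞ M] :=
  ContMDiffRiemannianMetric I ∞ E (fun x : M ↦ TangentSpace I x)

/-- An affine connection on `M`: `cov Y x u` is the value at `x` of `∇_u Y`.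
Its smoothness is the separate class `CovariantDerivative.ContMDiffCovariantDerivative cov ∞`. -/
abbrev AffineConnection (I : ModelWithCorners ℝ E H) (M : Type*) [TopologicalSpace M]
    [ChartedSpace H M] [IsManifold I ∞ M] :=
  CovariantDerivative I E (fun x : M ↦ TangentSpace I x)

/-- An `h`-orthonormal basis of the tangent space at `x`, in which all traces are computed. -/
def frame (h : Metric I M) (x : M) : Basis (Fin (finrank ℝ E)) ℝ (TangentSpace I x) :=
  letI : RiemannianBundle (fun x : M ↦ TangentSpace I x) := ⟨h.toRiemannianMetric⟩
  haveI : FiniteDimensional ℝ (TangentSpace I x) := inferInstanceAs (FiniteDimensional ℝ E)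
  (stdOrthonormalBasis ℝ (TangentSpace I x)).toBasis

theorem inner_frame (h : Metric I M) (x : M) (i j : Fin (finrank ℝ E)) :
    h.inner x (frame h x i) (frame h x j) = if i = j then 1 else 0 := by
  let _ : RiemannianBundle (fun x : M ↦ TangentSpace I x) := ⟨h.toRiemannianMetric⟩
  have : FiniteDimensional ℝ (TangentSpace I x) := inferInstanceAs (FiniteDimensional ℝ E)
  have := (stdOrthonormalBasis ℝ (TangentSpace I x)).inner_eq_ite i j
  simpa [frame] using! this

theorem sum_inner_frame (h : Metric I M) (x : M) (w : TangentSpace I x) :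
    ∑ i, h.inner x w (frame h x i) • frame h x i = w := by
  conv_rhs => rw [← (frame h x).sum_repr w]
  refine Finset.sum_congr rfl fun i _ ↦ ?_
  congr 1
  conv_lhs => rw [← (frame h x).sum_repr w]
  simp only [map_sum, map_smul, sum_apply, smul_apply, inner_frame, smul_eq_mul, mul_ite, mul_one,
    mul_zero, Finset.sum_ite_eq', Finset.mem_univ, if_true]

theorem inner_sum_frame (h : Metric I M) (x : M) (φ : TangentSpace I x →L[ℝ] ℝ)
    (w : TangentSpace I x) : h.inner x (∑ i, φ (frame h x i) • frame h x i) w = φ w := by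
  conv_rhs => rw [← sum_inner_frame h x w]
  simp only [map_sum, map_smul, sum_apply, smul_apply, smul_eq_mul]
  refine Finset.sum_congr rfl fun i _ ↦ ?_
  rw [h.symm x w, mul_comm]

set_option linter.unusedSectionVars false in
theorem mdifferentiableAt_inner (h : Metric I M) {x : M} {X Y : Π x : M, TangentSpace I x}
    (hX : MDiffAt (T% X) x) (hY : MDiffAt (T% Y) x) : MDiffAt (fun y ↦ h.inner y (X y) (Y y)) x := by
  have h1 : MDifferentiableAt I (I.prod 𝓘(ℝ, E →L[ℝ] E →L[ℝ] ℝ)) (fun b ↦ TotalSpace.mk' (E →L[ℝ] E →L[ℝ] ℝ) (E := fun x : M ↦ TangentSpace I x →L[ℝ] TangentSpace I x →L[ℝ] ℝ) b (h.inner b)) x := h.contMDiff.contMDiffAt.mdifferentiableAt (by simp)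
  have := MDifferentiableAt.clm_bundle_apply₂ (F₃ := ℝ) (E₃ := fun _ : M ↦ ℝ) h1 hX hY
  simp only [mdifferentiableAt_totalSpace] at this
  exact this.2

/-- Half of the right-hand side of the Koszul formula: the value of `h(D_X Y, Z)` at `x` for the
Levi-Civita connection `D`. -/
def koszul (h : Metric I M) (X Y Z : Π x : M, TangentSpace I x) (x : M) : ℝ :=
  (1 / 2) * (d% (fun y ↦ h.inner y (Y y) (Z y)) x (X x)
    + d% (fun y ↦ h.inner y (X y) (Z y)) x (Y x)
    - d% (fun y ↦ h.inner y (X y) (Y y)) x (Z x)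
    + h.inner x (mlieBracket I X Y x) (Z x)
    - h.inner x (mlieBracket I X Z x) (Y x)
    - h.inner x (mlieBracket I Y Z x) (X x))

theorem koszul_tensorial_left (h : Metric I M) {x : M} {Y Z : Π x : M, TangentSpace I x}
    (hY : MDiffAt (T% Y) x) (hZ : MDiffAt (T% Z) x) :
    TensorialAt I E (fun X ↦ koszul h X Y Z x) x where
  smul {f X} hf hX := by
    simp [koszul, mvfderiv_fun_mul hf (mdifferentiableAt_inner h hX hY),
      mvfderiv_fun_mul hf (mdifferentiableAt_inner h hX hZ), mlieBracket_smul_left hf hX]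
    ring
  add hX hX' := by
    simp [koszul, mvfderiv_fun_add (mdifferentiableAt_inner h hX hY) (mdifferentiableAt_inner h hX' hY),
      mvfderiv_fun_add (mdifferentiableAt_inner h hX hZ) (mdifferentiableAt_inner h hX' hZ),
      mlieBracket_add_left hX hX']
    ring

theorem koszul_tensorial_right (h : Metric I M) {x : M} {X Y : Π x : M, TangentSpace I x}
    (hX : MDiffAt (T% X) x) (hY : MDiffAt (T% Y) x) :
    TensorialAt I E (fun Z ↦ koszul h X Y Z x) x where
  smul {f Z} hf hZ := by
    simp [koszul, mvfderiv_fun_mul hf (mdifferentiableAt_inner h hX hZ),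
      mvfderiv_fun_mul hf (mdifferentiableAt_inner h hY hZ), mlieBracket_smul_right hf hZ]
    rw [h.symm x (Z x) (Y x), h.symm x (Z x) (X x)]
    ring
  add hZ hZ' := by
    simp [koszul, mvfderiv_fun_add (mdifferentiableAt_inner h hX hZ) (mdifferentiableAt_inner h hX hZ'),
      mvfderiv_fun_add (mdifferentiableAt_inner h hY hZ) (mdifferentiableAt_inner h hY hZ'),
      mlieBracket_add_right hZ hZ']
    ring

theorem koszul_add_middle (h : Metric I M) {x : M} {X Y Y' Z : Π x : M, TangentSpace I x}
    (hX : MDiffAt (T% X) x) (hY : MDiffAt (T% Y) x) (hY' : MDiffAt (T% Y') x)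
    (hZ : MDiffAt (T% Z) x) :
    koszul h X (Y + Y') Z x = koszul h X Y Z x + koszul h X Y' Z x := by
  simp [koszul, mvfderiv_fun_add (mdifferentiableAt_inner h hX hY) (mdifferentiableAt_inner h hX hY'),
      mvfderiv_fun_add (mdifferentiableAt_inner h hY hZ) (mdifferentiableAt_inner h hY' hZ),
      mlieBracket_add_right hY hY', mlieBracket_add_left hY hY']
  ring

theorem koszul_smul_middle (h : Metric I M) {x : M} {f : M → ℝ}
    {X Y Z : Π x : M, TangentSpace I x} (hf : MDiffAt f x)
    (hX : MDiffAt (T% X) x) (hY : MDiffAt (T% Y) x) (hZ : MDiffAt (T% Z) x) :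
    koszul h X (f • Y) Z x = f x * koszul h X Y Z x + d% f x (X x) * h.inner x (Y x) (Z x) := by
  simp [koszul, mvfderiv_fun_mul hf (mdifferentiableAt_inner h hX hY),
      mvfderiv_fun_mul hf (mdifferentiableAt_inner h hY hZ), mlieBracket_smul_right hf hY, mlieBracket_smul_left hf hY]
  rw [h.symm x (Y x) (X x)]
  ring


/-- The Levi-Civita connection of `h`, defined by the Koszul formula. It is torsion-free
(`leviCivita_torsion`) and metric (`leviCivita_metric`). -/
def leviCivita (h : Metric I M) : AffineConnection I M where
  toFun Y x :=
    open scoped Classical in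
    if hY : MDiffAt (T% Y) x then
      ∑ i, (TensorialAt.mkHom (fun X ↦ koszul h X Y (FiberBundle.extend E (frame h x i)) x) x
        (koszul_tensorial_left h hY (FiberBundle.mdifferentiableAt_extend I E _))).smulRight (frame h x i)
    else 0
  isCovariantDerivativeOnUniv := {
    add := by
      intro Y Y' x hY hY' _
      have hYY : MDiffAt (T% (Y + Y')) x := mdifferentiableAt_add_section hY hY'
      simp only [hY, hY', hYY, dif_pos]
      ext u
      simp only [sum_apply, ContinuousLinearMap.smulRight_apply,
        add_apply, TensorialAt.mkHom_apply_eq_extend, ← Finset.sum_add_distrib,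
        ← add_smul]
      refine Finset.sum_congr rfl fun i _ ↦ ?_
      rw [koszul_add_middle h (FiberBundle.mdifferentiableAt_extend I E _) hY hY'
        (FiberBundle.mdifferentiableAt_extend I E _)]
    leibniz := by
      intro Y f x hY hf _
      have hfY : MDiffAt (T% (f • Y)) x := hf.smul_section hY
      simp only [hY, hfY, dif_pos]
      ext u
      simp only [sum_apply, ContinuousLinearMap.smulRight_apply,
        add_apply, TensorialAt.mkHom_apply_eq_extend,
        smul_apply]
      simp only [koszul_smul_middle h hf (FiberBundle.mdifferentiableAt_extend I E _) hY
        (FiberBundle.mdifferentiableAt_extend I E _), add_smul, Finset.sum_add_distrib, mul_smul,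
        Finset.smul_sum, FiberBundle.extend_apply_self]
      congr 1
      rw [← Finset.smul_sum, sum_inner_frame] }

theorem leviCivita_apply (h : Metric I M) {x : M} {X Y : Π x : M, TangentSpace I x}
    (hX : MDiffAt (T% X) x) (hY : MDiffAt (T% Y) x) :
    leviCivita h Y x (X x) =
      ∑ i, koszul h X Y (FiberBundle.extend E (frame h x i)) x • frame h x i := by
  simp only [leviCivita, hY, dif_pos, sum_apply, ContinuousLinearMap.smulRight_apply]
  refine Finset.sum_congr rfl fun i _ ↦ ?_
  rw [TensorialAt.mkHom_apply (Φ := fun X ↦ koszul h X Y (FiberBundle.extend E (frame h x i)) x)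
    _ hX]

theorem inner_leviCivita (h : Metric I M) {x : M} {X Y Z : Π x : M, TangentSpace I x}
    (hX : MDiffAt (T% X) x) (hY : MDiffAt (T% Y) x) (hZ : MDiffAt (T% Z) x) :
    h.inner x (leviCivita h Y x (X x)) (Z x) = koszul h X Y Z x := by
  have hK := koszul_tensorial_right h hX hY
  rw [← TensorialAt.mkHom_apply hK hZ, ← inner_sum_frame h x (TensorialAt.mkHom _ x hK),
    leviCivita_apply h hX hY]
  rfl

theorem leviCivita_torsion (h : Metric I M) : (leviCivita h).torsion = 0 := by
  rw [CovariantDerivative.torsion_eq_zero_iff]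
  intro X Y x hX hY
  rw [← sum_inner_frame h x (mlieBracket I X Y x), leviCivita_apply h hX hY,
    leviCivita_apply h hY hX, ← Finset.sum_sub_distrib]
  refine Finset.sum_congr rfl fun i _ ↦ ?_
  rw [← sub_smul]
  congr 1
  simp only [koszul, mlieBracket_swap_apply (V := Y) (W := X), FiberBundle.extend_apply_self]
  simp [h.symm _ (X _) (Y _)]
  ring

/-- The covariant derivative of the metric:
`u ↦ (∇_u h)(V, W) = u(h(V, W)) - h(∇_u V, W) - h(V, ∇_u W)`. -/
def metricDeriv (h : Metric I M) (cov : AffineConnection I M) (V W : Π x : M, TangentSpace I x)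
    (x : M) : TangentSpace I x →L[ℝ] ℝ :=
  d% (fun y ↦ h.inner y (V y) (W y)) x - (h.inner x (W x)).comp (cov V x)
    - (h.inner x (V x)).comp (cov W x)

theorem leviCivita_metric (h : Metric I M) {x : M} {V W : Π x : M, TangentSpace I x}
    (hV : MDiffAt (T% V) x) (hW : MDiffAt (T% W) x) : metricDeriv h (leviCivita h) V W x = 0 := by
  ext u
  have hu : MDiffAt (T% (FiberBundle.extend E u)) x := FiberBundle.mdifferentiableAt_extend I E u
  have h1 := inner_leviCivita h hu hV hW
  have h2 := inner_leviCivita h hu hW hV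
  rw [FiberBundle.extend_apply_self] at h1 h2
  simp only [metricDeriv, sub_apply, ContinuousLinearMap.comp_apply, zero_apply]
  rw [h.symm x (W x), h.symm x (V x), h1, h2]
  simp only [koszul, mlieBracket_swap_apply (V := W) (W := V), FiberBundle.extend_apply_self,
    map_neg, neg_apply, fun y ↦ h.symm y (W y) (V y)]
  ring

/-- The connection conjugate to `∇`: `∇_i + h^{kp} ∇_i h_{jp}`, that is, the connection `∇'` with
`h(∇'_u V, W) = h(∇_u V, W) + (∇_u h)(V, W)`. -/
def conjugate (h : Metric I M) (cov : AffineConnection I M) : AffineConnection I M where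
  toFun V x := cov V x +
    ∑ i, (metricDeriv h cov V (FiberBundle.extend E (frame h x i)) x).smulRight (frame h x i)
  isCovariantDerivativeOnUniv := {
    add := by
      intro V V' x hV hV' _
      have hE (i) := FiberBundle.mdifferentiableAt_extend I E (frame h x i)
      ext u
      simp [metricDeriv, cov.isCovariantDerivativeOn.add hV hV', 
        mvfderiv_fun_add (mdifferentiableAt_inner h hV (hE _)) (mdifferentiableAt_inner h hV' (hE _))]
      rw [add_add_add_comm, ← Finset.sum_add_distrib]
      congr 1
      refine Finset.sum_congr rfl fun i _ ↦ ?_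
      module
    leibniz := by
      intro V f x hV hf _
      have hE (i) := FiberBundle.mdifferentiableAt_extend I E (frame h x i)
      ext u
      simp [metricDeriv, cov.isCovariantDerivativeOn.leibniz hV hf,
        mvfderiv_fun_mul hf (mdifferentiableAt_inner h hV (hE _))]
      rw [add_right_comm, add_left_inj, Finset.smul_sum, add_right_inj]
      refine Finset.sum_congr rfl fun i _ ↦ ?_
      rw [h.symm x (frame h x i) (V x)]
      module }

/-- Evaluation of covectors at a tangent vector. -/
def evalAt {x : M} (v : TangentSpace I x) : (TangentSpace I x →L[ℝ] ℝ) →L[ℝ] ℝ :=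
  (ContinuousLinearMap.apply (E := E) ℝ ℝ v :)

/-- Raising the index of a covector with `h`, see `inner_raise`. -/
def raise (h : Metric I M) (x : M) : (TangentSpace I x →L[ℝ] ℝ) →L[ℝ] TangentSpace I x :=
  ∑ i, (evalAt (frame h x i)).smulRight (frame h x i)

theorem inner_raise (h : Metric I M) (x : M) (φ : TangentSpace I x →L[ℝ] ℝ)
    (w : TangentSpace I x) : h.inner x (raise h x φ) w = φ w := by
  rw [← inner_sum_frame h x φ w]
  simp only [raise, sum_apply, ContinuousLinearMap.smulRight_apply]
  rfl


/-- Covariant three-tensors. -/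
abbrev CubicTensor (I : ModelWithCorners ℝ E H) (M : Type*) [TopologicalSpace M]
    [ChartedSpace H M] :=
  Π x : M, TangentSpace I x →L[ℝ] TangentSpace I x →L[ℝ] TangentSpace I x →L[ℝ] ℝ

/-- The tensor `om_{ij}^k` obtained by raising the last index:
`h(cubicEndo h om x v u, w) = om(u, v, w)`; the direction of differentiation `u` comes last, as in
`CovariantDerivative`. -/
def cubicEndo (h : Metric I M) (om : CubicTensor I M) (x : M) :
    TangentSpace I x →L[ℝ] TangentSpace I x →L[ℝ] TangentSpace I x :=
  (ContinuousLinearMap.postcomp (TangentSpace I x) (raise h x)).comp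
    (ContinuousLinearMap.flip (E := E) (F := E) (G := E →L[ℝ] ℝ) (om x) :
      TangentSpace I x →L[ℝ] TangentSpace I x →L[ℝ] TangentSpace I x →L[ℝ] ℝ)

theorem inner_cubicEndo (h : Metric I M) (om : CubicTensor I M) (x : M)
    (u v w : TangentSpace I x) : h.inner x (cubicEndo h om x v u) w = om x u v w :=
  inner_raise h x (om x u v) w

/-- The difference tensor `∇ - D` with its last index lowered:
`om(u, V, w) = h(∇_u V - D_u V, w)`, see `differenceCubic_apply`. -/
def differenceCubic (h : Metric I M) (cov : AffineConnection I M) : CubicTensor I M := fun x ↦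
  (ContinuousLinearMap.postcomp (TangentSpace I x) (h.inner x)).comp
    (ContinuousLinearMap.flip (E := E) (F := E) (G := E) (cov.difference (leviCivita h) x) :
      TangentSpace I x →L[ℝ] TangentSpace I x →L[ℝ] TangentSpace I x)

theorem differenceCubic_apply (h : Metric I M) (cov : AffineConnection I M) {x : M}
    (u w : TangentSpace I x) {V : Π x : M, TangentSpace I x} (hV : MDiffAt (T% V) x) :
    differenceCubic h cov x u (V x) w = h.inner x (cov V x u - leviCivita h V x u) w := by
  rw [← sub_apply, ← IsCovariantDerivativeOn.difference_apply cov.isCovariantDerivativeOnUniv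
    (leviCivita h).isCovariantDerivativeOnUniv trivial hV]
  rfl

/-! ### Tensor calculus

Derivatives and curvatures at a point are computed with extensions of tangent vectors to vector
fields that are smooth near the point; the results do not depend on the extensions. -/

/-- The fixed extension of a tangent vector at `x` to a vector field, smooth near `x`. -/
abbrev ext {x : M} (v : TangentSpace I x) : Π y : M, TangentSpace I y :=
  FiberBundle.extend E v

/-- `(∇_u h)(v, w)`. -/
def nablaMetric (h : Metric I M) (cov : AffineConnection I M) (x : M)
    (u v w : TangentSpace I x) : ℝ :=
  metricDeriv h cov (ext v) (ext w) x u

/-- `∇_{[i} h_{j]k} = 0`. -/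
def IsMetricCodazzi (h : Metric I M) (cov : AffineConnection I M) : Prop :=
  ∀ (x : M) (u v w : TangentSpace I x), nablaMetric h cov x u v w = nablaMetric h cov x v u w

/-- `det h` as a section of the tensor square of the top exterior power of the cotangent bundle:
`(v, w) ↦ det (h(v_i, w_j))`. -/
def detMetric (h : Metric I M) (x : M) (v w : Fin (finrank ℝ E) → TangentSpace I x) : ℝ :=
  Matrix.det (Matrix.of fun i j ↦ h.inner x (v i) (w j))

/-- `(∇_u det h)(v, w)`, by the Leibniz rule. -/
def nablaDet (h : Metric I M) (cov : AffineConnection I M) (x : M) (u : TangentSpace I x)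
    (v w : Fin (finrank ℝ E) → TangentSpace I x) : ℝ :=
  d% (fun y ↦ detMetric h y (fun i ↦ ext (v i) y) (fun i ↦ ext (w i) y)) x u
    - ∑ i, detMetric h x (Function.update v i (cov (ext (v i)) x u)) w
    - ∑ i, detMetric h x v (Function.update w i (cov (ext (w i)) x u))

/-- `∇_i det h = 0`. -/
def IsDetParallel (h : Metric I M) (cov : AffineConnection I M) : Prop :=
  ∀ (x : M) (u : TangentSpace I x) (v w : Fin (finrank ℝ E) → TangentSpace I x),
    nablaDet h cov x u v w = 0

/-- `(∇_u om)(v, w, z)`. -/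
def nablaCubic (cov : AffineConnection I M) (om : CubicTensor I M) (x : M)
    (u v w z : TangentSpace I x) : ℝ :=
  d% (fun y ↦ om y (ext v y) (ext w y) (ext z y)) x u
    - om x (cov (ext v) x u) w z - om x v (cov (ext w) x u) z - om x v w (cov (ext z) x u)

/-- The curvature `R(u, v) w = ∇_u ∇_v w - ∇_v ∇_u w - ∇_{[u, v]} w`; in indices
`R_{ijk}^l u^i v^j w^k`. -/
def curvature (cov : AffineConnection I M) (x : M) (u v w : TangentSpace I x) :
    TangentSpace I x :=
  cov (fun y ↦ cov (ext w) y (ext v y)) x u - cov (fun y ↦ cov (ext w) y (ext u y)) x v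
    - cov (ext w) x (mlieBracket I (ext u) (ext v) x)

/-- `R_{ijkl} = R_{ijk}^p h_{pl}`. -/
def curvatureLow (h : Metric I M) (cov : AffineConnection I M) (x : M)
    (u v w z : TangentSpace I x) : ℝ :=
  h.inner x (curvature cov x u v w) z

/-- `R_{ij} = R_{pij}^p`: the trace of `u ↦ R(u, v) w`. -/
def ricci (h : Metric I M) (cov : AffineConnection I M) (x : M) (v w : TangentSpace I x) : ℝ :=
  ∑ p, (frame h x).coord p (curvature cov x (frame h x p) v w)

/-- `R = h^{ij} R_{ij}`. -/
def scalar (h : Metric I M) (cov : AffineConnection I M) (x : M) : ℝ :=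
  ∑ p, ricci h cov x (frame h x p) (frame h x p)

/-- The curvature of the connection equals that of its conjugate. -/
def IsSelfConjugate (h : Metric I M) (cov : AffineConnection I M) : Prop :=
  ∀ (x : M) (u v w : TangentSpace I x),
    curvature cov x u v w = curvature (conjugate h cov) x u v w

/-- The symmetries of a metric curvature tensor:
`Y_{[ij]kl} = Y_{ijkl} = Y_{ij[kl]}` and `Y_{[ijk]l} = 0`. -/
structure IsMetricCurvatureType {V : Type*} (Y : V → V → V → V → ℝ) : Prop where
  antisymm_left : ∀ u v w z, Y v u w z = -Y u v w z
  antisymm_right : ∀ u v w z, Y u v z w = -Y u v w z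
  bianchi : ∀ u v w z, Y u v w z + Y v w u z + Y w u v z = 0

/-! ### Trace-free cubic tensors and the coupled system -/

set_option maxSynthPendingDepth 3 in
set_option synthInstance.maxHeartbeats 200000 in
/-- Smooth sections of the bundle of completely symmetric `h`-trace-free covariant 3-tensors. -/
structure IsTraceFreeCubic (h : Metric I M) (om : CubicTensor I M) : Prop where
  smooth : ContMDiff I (I.prod 𝓘(ℝ, E →L[ℝ] E →L[ℝ] E →L[ℝ] ℝ)) ∞
    (fun x ↦ TotalSpace.mk' (E →L[ℝ] E →L[ℝ] E →L[ℝ] ℝ)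
      (E := fun x : M ↦
        TangentSpace I x →L[ℝ] TangentSpace I x →L[ℝ] TangentSpace I x →L[ℝ] ℝ) x (om x))
  symm_left : ∀ (x : M) (u v w : TangentSpace I x), om x u v w = om x v u w
  symm_right : ∀ (x : M) (u v w : TangentSpace I x), om x u v w = om x u w v
  trace_free : ∀ (x : M) (u : TangentSpace I x), ∑ p, om x u (frame h x p) (frame h x p) = 0

/-- `D_{[i} om_{j]kl} = 0` for the Levi-Civita connection `D`. -/
def IsCodazzi (h : Metric I M) (om : CubicTensor I M) : Prop :=
  ∀ (x : M) (u v w z : TangentSpace I x),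
    nablaCubic (leviCivita h) om x u v w z = nablaCubic (leviCivita h) om x v u w z

/-- `|om|^2`, by complete contraction. -/
def normSq (h : Metric I M) (om : CubicTensor I M) (x : M) : ℝ :=
  ∑ p, ∑ q, ∑ r, om x (frame h x p) (frame h x q) (frame h x r) ^ 2

/-- The divergence `D^p om_{pij}`. -/
def divergence (h : Metric I M) (om : CubicTensor I M) (x : M) (v w : TangentSpace I x) : ℝ :=
  ∑ p, nablaCubic (leviCivita h) om x (frame h x p) (frame h x p) v w

/-- The completely trace-free part of `D_{[i} om_{j]kl}`, for trace-free `om`: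
`D_{[i} om_{j]kl} - (1/n) (h_{k[i} div(om)_{j]l} + h_{l[i} div(om)_{j]k})`. -/
def codazziOp (h : Metric I M) (om : CubicTensor I M) (x : M) (u v w z : TangentSpace I x) : ℝ :=
  (1 / 2) * (nablaCubic (leviCivita h) om x u v w z - nablaCubic (leviCivita h) om x v u w z)
    - (1 / (finrank ℝ E : ℝ)) *
      ((1 / 2) * (h.inner x w u * divergence h om x v z - h.inner x w v * divergence h om x u z)
        + (1 / 2) *
          (h.inner x z u * divergence h om x v w - h.inner x z v * divergence h om x u w))

/-- The one-form `om^{pqr} K(om)_{ipqr}`, with `K` the operator `codazziOp`. -/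
def codazziForm (h : Metric I M) (om : CubicTensor I M) (x : M) (u : TangentSpace I x) : ℝ :=
  ∑ p, ∑ q, ∑ r, om x (frame h x p) (frame h x q) (frame h x r) *
    codazziOp h om x u (frame h x p) (frame h x q) (frame h x r)

/-- The one-form `om_i^{pq} div(om)_{pq}`. -/
def divergenceForm (h : Metric I M) (om : CubicTensor I M) (x : M) (u : TangentSpace I x) : ℝ :=
  ∑ p, ∑ q, om x u (frame h x p) (frame h x q) * divergence h om x (frame h x p) (frame h x q)

/-- The curvature-type product
`(a ∧ b)_{ijkl} = a_{k[i}^p b_{j]lp} - a_{l[i}^p b_{j]kp}` of symmetric 3-tensors. -/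
def kulkarniNomizu (h : Metric I M) (a b : CubicTensor I M) (x : M)
    (u v w z : TangentSpace I x) : ℝ :=
  ∑ p, ((1 / 2) * (a x w u (frame h x p) * b x v z (frame h x p)
        - a x w v (frame h x p) * b x u z (frame h x p))
      - (1 / 2) * (a x z u (frame h x p) * b x v w (frame h x p)
        - a x z v (frame h x p) * b x u w (frame h x p)))

/-- The Ricci trace `(om ∧ om)_{pij}^p`. -/
def cubicRicci (h : Metric I M) (om : CubicTensor I M) (x : M) (v w : TangentSpace I x) : ℝ :=
  ∑ p, kulkarniNomizu h om om x (frame h x p) v w (frame h x p)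

/-- The system coupling `h` to `om`, for rank `k = 3` and constants `κ` and `c`:
`0 = -2 (n + k - 3) om^{pqr} K(om)_{ipqr} + (n - 2) om_i^{pq} div(om)_{pq}` and
`R_{ij} - (1/2) R_h h_{ij} + ((n-2)/(2n)) κ h_{ij} = c (ric(om ∧ om)_{ij} - (1/2) |om|^2 h_{ij})`. -/
structure SolvesCoupledSystem (h : Metric I M) (om : CubicTensor I M) (κ c : ℝ) : Prop where
  conservation : ∀ (x : M) (u : TangentSpace I x),
    0 = -2 * (finrank ℝ E : ℝ) * codazziForm h om x u
      + ((finrank ℝ E : ℝ) - 2) * divergenceForm h om x u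
  einstein : ∀ (x : M) (v w : TangentSpace I x),
    ricci h (leviCivita h) x v w - (1 / 2) * scalar h (leviCivita h) x * h.inner x v w
        + ((finrank ℝ E : ℝ) - 2) / (2 * (finrank ℝ E : ℝ)) * κ * h.inner x v w
      = c * (cubicRicci h om x v w - (1 / 2) * normSq h om x * h.inner x v w)

/-- The connection `D + s om_{ij}^k`, with `D` the Levi-Civita connection of `h`. -/
def cubicConnection (h : Metric I M) (om : CubicTensor I M) (s : ℝ) : AffineConnection I M :=
  (leviCivita h).addOneForm (fun x ↦ s • cubicEndo h om x)

end EinsteinCubic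

end

/-! Write `∇ = D + s ω`, with the last index of `ω` raised by `h`. Everything rests on one
expansion, `IsCubicPerturbation.curvatureLow_eq`: the curvature of `∇` is that of `D`, plus `s`
times the antisymmetrized `Dω`, plus `s²` times an expression quadratic in `ω`. The linear term
changes sign with `s`, the quadratic one does not. When `ω` is symmetric in its last two indices,
conjugation replaces `s` by `-s` (`IsCubicPerturbation.conjugate`), so self-conjugate curvature
forces the linear term to vanish, which is the Codazzi equation. Conversely, a Codazzi `ω` gives
`∇⁺` and `∇⁻` the same curvature.

The first-order conditions are algebraic in `ω`. Vanishing torsion is symmetry in the first two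
indices. Given this, `∇_{[i}h_{j]k} = 0` is symmetry in the last two, and then `∇h = -2sω`, so `∇
det h = 0` says that `ω` is trace-free.

For a trace-free `ω`, contracting the quadratic term gives `Ric(∇) = Ric(D) - ρ(ω)`. The Einstein
equation of the coupled system is the trace-reversed form of `Ric(D) - ρ(ω) = (κ/n) h`
(`IsTraceFreeCubic.einstein_iff`); undoing the reversal divides by `n - 2`. The other equation holds
because both of its terms vanish: a Codazzi `ω` has totally symmetric `Dω`, so its divergence is a
trace over two tensor slots, which is zero since `D` commutes with traces
(`IsTraceFreeCubic.sum_nablaCubic`).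

The orthonormal `frame` is chosen point by point, with no continuity in the point. Whatever must be
differentiated is therefore expressed in smooth, non-orthonormal frames with their Gram matrices,
and smoothness is tested on smooth vector fields. -/

noncomputable section

namespace EinsteinCubic

variable {E : Type*} [NormedAddCommGroup E] [NormedSpace ℝ E] [FiniteDimensional ℝ E]
  {H : Type*} [TopologicalSpace H] {I : ModelWithCorners ℝ E H}
  {M : Type*} [TopologicalSpace M] [ChartedSpace H M] [IsManifold I ∞ M]

set_option linter.unusedSectionVars false

open scoped Topology
open Filter

/-! ### Smoothness of bundle maps, tested on smooth sections -/

section Sections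

variable {F₁ : Type*} [NormedAddCommGroup F₁] [NormedSpace ℝ F₁] {V₁ : M → Type*}
  [TopologicalSpace (TotalSpace F₁ V₁)] [∀ x, AddCommGroup (V₁ x)] [∀ x, Module ℝ (V₁ x)]
  [∀ x, TopologicalSpace (V₁ x)] [FiberBundle F₁ V₁] [VectorBundle ℝ F₁ V₁]
  {F₂ : Type*} [NormedAddCommGroup F₂] [NormedSpace ℝ F₂] {V₂ : M → Type*}
  [TopologicalSpace (TotalSpace F₂ V₂)] [∀ x, AddCommGroup (V₂ x)] [∀ x, Module ℝ (V₂ x)]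
  [∀ x, TopologicalSpace (V₂ x)] [FiberBundle F₂ V₂] [VectorBundle ℝ F₂ V₂]
  [∀ x, IsTopologicalAddGroup (V₂ x)] [∀ x, ContinuousSMul ℝ (V₂ x)]

/-- Near every point, a section that is smooth near the point agrees with a globally smooth one. -/
theorem exists_contMDiff_section_eventuallyEq [T2Space M] {σ : Π x : M, V₁ x} {x : M} {u : Set M}
    (hu : u ∈ 𝓝 x) (hσ : CMDiff[u] ∞ (T% σ)) :
    ∃ τ : Π x : M, V₁ x, CMDiff ∞ (T% τ) ∧ ∀ᶠ y in 𝓝 x, τ y = σ y := by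
  obtain ⟨v, hvu, hv, hxv⟩ := mem_nhds_iff.1 hu
  obtain ⟨f, -, hf⟩ := (SmoothBumpFunction.nhds_basis_tsupport (I := I) x).mem_iff.1
    (hv.mem_nhds hxv)
  refine ⟨(f : M → ℝ) • σ, (f.contMDiff.contMDiffOn).smul_section_of_tsupport hv hf
    (hσ.mono hvu), ?_⟩
  filter_upwards [f.eventuallyEq_one] with y hy
  simp [hy]

/-- A section of a bundle of homomorphisms is smooth as soon as it maps smooth sections to smooth
sections. -/
theorem contMDiffAt_hom_section [T2Space M] [FiniteDimensional ℝ F₁]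
    [ContMDiffVectorBundle ∞ F₁ V₁ I]
    {A : Π y : M, V₁ y →L[ℝ] V₂ y} {x : M}
    (hA : ∀ σ : Π y : M, V₁ y, CMDiff ∞ (T% σ) → CMDiffAt ∞ (T% (fun y ↦ A y (σ y))) x) :
    ContMDiffAt I (I.prod 𝓘(ℝ, F₁ →L[ℝ] F₂)) ∞
      (fun y ↦ TotalSpace.mk' (F₁ →L[ℝ] F₂) (E := fun y : M ↦ V₁ y →L[ℝ] V₂ y) y (A y)) x := by
  rw [contMDiffAt_hom_bundle]
  refine ⟨contMDiffAt_id, ?_⟩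
  set e₁ := trivializationAt F₁ V₁ x
  set e₂ := trivializationAt F₂ V₂ x
  have hx₁ : x ∈ e₁.baseSet := FiberBundle.mem_baseSet_trivializationAt' x
  have hx₂ : x ∈ e₂.baseSet := FiberBundle.mem_baseSet_trivializationAt' x
  let b := Module.finBasis ℝ F₁
  have hs (i) : CMDiffAt ∞ (fun y ↦ (e₂ ⟨y, A y (e₁.localFrame b i y)⟩).2) x := by
    obtain ⟨τ, hτ, hτe⟩ := exists_contMDiff_section_eventuallyEq (e₁.open_baseSet.mem_nhds hx₁)
      (e₁.contMDiffOn_localFrame_baseSet (I := I) ∞ b i)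
    have := (contMDiffAt_section _).1 (hA τ hτ)
    refine this.congr_of_eventuallyEq ?_
    filter_upwards [hτe] with y hy
    rw [hy]
  -- In the trivializations, `A` is the sum over a basis of (dual basis covector) ⊗ (image of the
  -- frame section), and each image is smooth by hypothesis.
  have hsum : CMDiffAt ∞ (fun y ↦ ∑ i, ContinuousLinearMap.smulRightL ℝ F₁ F₂
      (LinearMap.toContinuousLinearMap (b.coord i)) (e₂ ⟨y, A y (e₁.localFrame b i y)⟩).2) x := by
    refine ContMDiffAt.sum fun i _ ↦ ?_
    exact (ContinuousLinearMap.contMDiffAt _).comp x (hs i)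
  refine hsum.congr_of_eventuallyEq ?_
  filter_upwards [e₁.open_baseSet.mem_nhds hx₁, e₂.open_baseSet.mem_nhds hx₂] with y hy₁ hy₂
  refine ContinuousLinearMap.coe_injective (b.ext fun j ↦ ?_)
  simp [ContinuousLinearMap.inCoordinates_eq hy₁ hy₂, Finsupp.single_apply, hy₁,
    Bundle.Trivialization.basisAt, ContinuousLinearMap.smulRightL, e₁, e₂]

end Sections

/-! ### Smoothness of determinants, adjugates and inverses -/

section Matrices

variable {ι : Type*} [Fintype ι] [DecidableEq ι] {A : M → Matrix ι ι ℝ} {x : M}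

theorem contMDiffAt_det (hA : ∀ i j, CMDiffAt ∞ (fun y ↦ A y i j) x) :
    CMDiffAt ∞ (fun y ↦ (A y).det) x := by
  simp only [Matrix.det_apply, Units.smul_def, zsmul_eq_mul]
  exact ContMDiffAt.sum fun σ _ ↦ contMDiffAt_const.mul (contMDiffAt_finsetProd fun i _ ↦ hA _ _)

theorem contMDiffAt_adjugate (hA : ∀ i j, CMDiffAt ∞ (fun y ↦ A y i j) x) (i j : ι) :
    CMDiffAt ∞ (fun y ↦ (A y).adjugate i j) x := by
  simp only [Matrix.adjugate_apply]
  refine contMDiffAt_det fun k l ↦ ?_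
  by_cases hk : k = j
  · subst hk
    simpa using contMDiffAt_const
  · simpa [Matrix.updateRow_ne hk] using hA k l

theorem contMDiffAt_matrix_inv (hA : ∀ i j, CMDiffAt ∞ (fun y ↦ A y i j) x)
    (hd : (A x).det ≠ 0) (i j : ι) : CMDiffAt ∞ (fun y ↦ (A y)⁻¹ i j) x := by
  simp only [Matrix.inv_def, Matrix.smul_apply, smul_eq_mul, Ring.inverse_eq_inv']
  exact ((contMDiffAt_det hA).inv₀ hd).mul (contMDiffAt_adjugate hA i j)

end Matrices

/-! ### Orthonormal frames and Gram matrices -/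

theorem frame_coord (h : Metric I M) (x : M) (p : Fin (finrank ℝ E)) (v : TangentSpace I x) :
    (frame h x).coord p v = h.inner x v (frame h x p) := by
  conv_lhs => rw [← sum_inner_frame h x v]
  simp [Finsupp.single_apply]

theorem inner_eq_sum (h : Metric I M) (x : M) (v w : TangentSpace I x) :
    h.inner x v w = ∑ p, h.inner x v (frame h x p) * h.inner x w (frame h x p) := by
  conv_lhs => rw [← sum_inner_frame h x w]
  simp [mul_comm]

theorem eq_of_inner_eq (h : Metric I M) {x : M} {v v' : TangentSpace I x}
    (hv : ∀ w, h.inner x v w = h.inner x v' w) : v = v' := by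
  rw [← sum_inner_frame h x v, ← sum_inner_frame h x v']
  simp only [hv]

/-- The matrix of pairwise inner products of two families of tangent vectors. -/
def gram (h : Metric I M) {ι : Type*} {x : M} (v w : ι → TangentSpace I x) : Matrix ι ι ℝ :=
  Matrix.of fun i j ↦ h.inner x (v i) (w j)

theorem gram_frame (h : Metric I M) (x : M) : gram h (frame h x) (frame h x) = 1 := by
  ext i j
  simp [gram, inner_frame, Matrix.one_apply]

theorem gram_mul (h : Metric I M) {x : M} (v w : Fin (finrank ℝ E) → TangentSpace I x) :
    gram h v w = gram h v (frame h x) * (gram h w (frame h x)).transpose := by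
  ext i j
  simp [gram, Matrix.mul_apply, ← inner_eq_sum]

theorem isUnit_det_gram (h : Metric I M) {x : M}
    (b : Basis (Fin (finrank ℝ E)) ℝ (TangentSpace I x)) : IsUnit (gram h b b).det := by
  have h1 : gram h b (frame h x) = ((frame h x).toMatrix b).transpose := by
    ext i j
    simp [gram, Basis.toMatrix_apply, ← frame_coord]
  have h2 : IsUnit (gram h b (frame h x)).det := by
    rw [h1, Matrix.det_transpose, ← Basis.det_apply]
    exact (frame h x).isUnit_det b
  rw [gram_mul, Matrix.det_mul, Matrix.det_transpose]
  exact h2.mul h2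

/-- Recovers a vector from its inner products with any basis, so that a smoothly varying frame can
replace the pointwise orthonormal one. -/
theorem sum_inv_gram (h : Metric I M) {x : M}
    (b : Basis (Fin (finrank ℝ E)) ℝ (TangentSpace I x)) (v : TangentSpace I x) :
    ∑ i, (∑ j, (gram h b b)⁻¹ i j * h.inner x v (b j)) • b i = v := by
  have hG : (gram h b b).transpose = gram h b b := by
    ext i j
    simp [gram, h.symm x (b j)]
  have hv : (fun j ↦ h.inner x v (b j)) = (gram h b b).mulVec (b.repr v) := by
    ext j
    conv_lhs => rw [← b.sum_repr v]
    simp only [map_sum, map_smul, sum_apply, smul_apply, smul_eq_mul, gram, Matrix.mulVec,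
      dotProduct, Matrix.of_apply, h.symm x (b j), mul_comm]
  conv_rhs => rw [← b.sum_repr v]
  refine Finset.sum_congr rfl fun i _ ↦ ?_
  congr 1
  change ((gram h b b)⁻¹.mulVec (fun j ↦ h.inner x v (b j))) i = _
  rw [hv, Matrix.mulVec_mulVec, Matrix.nonsing_inv_mul _ (isUnit_det_gram h b), Matrix.one_mulVec]

/-! ### Smoothness of brackets, derivatives and the Levi-Civita connection -/

section Smooth

variable {x : M} {X Y Z : Π y : M, TangentSpace I y}

theorem contMDiffAt_inner (h : Metric I M) (hX : CMDiffAt ∞ (T% X) x) (hY : CMDiffAt ∞ (T% Y) x) :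
    CMDiffAt ∞ (fun y ↦ h.inner y (X y) (Y y)) x := by
  have h1 : ContMDiffAt I (I.prod 𝓘(ℝ, E →L[ℝ] E →L[ℝ] ℝ)) ∞
      (fun b ↦ TotalSpace.mk' (E →L[ℝ] E →L[ℝ] ℝ)
        (E := fun x : M ↦ TangentSpace I x →L[ℝ] TangentSpace I x →L[ℝ] ℝ) b (h.inner b)) x :=
    h.contMDiff.contMDiffAt
  have := ContMDiffAt.clm_bundle_apply₂ (F₃ := ℝ) (E₃ := fun _ : M ↦ ℝ) h1 hX hY
  simp only [contMDiffAt_totalSpace] at this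
  exact this.2

/-- A vector field is smooth as soon as its inner products with smooth vector fields are smooth. -/
theorem contMDiffAt_of_inner [T2Space M] (h : Metric I M)
    (hX : ∀ Z : Π y : M, TangentSpace I y, CMDiff ∞ (T% Z) →
      CMDiffAt ∞ (fun y ↦ h.inner y (X y) (Z y)) x) : CMDiffAt ∞ (T% X) x := by
  set e := trivializationAt E (TangentSpace I : M → Type _) x
  have hx : x ∈ e.baseSet := FiberBundle.mem_baseSet_trivializationAt' x
  let b := Module.finBasis ℝ E
  have he (i) := exists_contMDiff_section_eventuallyEq (e.open_baseSet.mem_nhds hx)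
      (e.contMDiffOn_localFrame_baseSet (I := I) ∞ b i)
  choose Z hZ hZe using he
  have hZe' : ∀ᶠ y in 𝓝 x, ∃ B : Basis (Fin (finrank ℝ E)) ℝ (TangentSpace I y),
      (B : Fin (finrank ℝ E) → TangentSpace I y) = fun i ↦ Z i y := by
    filter_upwards [eventually_all.2 hZe, e.open_baseSet.mem_nhds hx] with y hy hye
    refine ⟨e.basisAt b hye, funext fun i ↦ ?_⟩
    rw [hy i, e.localFrame_apply_of_mem_baseSet b hye]
  have hG (i j) : CMDiffAt ∞ (fun y ↦ gram h (fun i ↦ Z i y) (fun i ↦ Z i y) i j) x :=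
    contMDiffAt_inner h (hZ i x) (hZ j x)
  have hd : (gram h (fun i ↦ Z i x) (fun i ↦ Z i x)).det ≠ 0 := by
    obtain ⟨B, hB⟩ := hZe'.self_of_nhds
    rw [← hB]
    exact (isUnit_det_gram h B).ne_zero
  -- Near `x` this sum is `X` itself, by `sum_inv_gram`; its coefficients are smooth because the
  -- Gram determinant is nonzero at `x`.
  have hsum : CMDiffAt ∞ (T% (fun y ↦ ∑ i, (∑ j, (gram h (fun i ↦ Z i y) (fun i ↦ Z i y))⁻¹ i j *
      h.inner y (X y) (Z j y)) • Z i y)) x := by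
    refine ContMDiffAt.sum_section fun i _ ↦ ContMDiffAt.smul_section ?_ (hZ i x)
    exact ContMDiffAt.sum fun j _ ↦ (contMDiffAt_matrix_inv hG hd i j).mul (hX _ (hZ j))
  refine hsum.congr_of_eventuallyEq ?_
  filter_upwards [hZe'] with y ⟨B, hB⟩
  have := sum_inv_gram h B (X y)
  rw [hB] at this
  simp only [this]

theorem eventually_mdifferentiableAt (hX : CMDiffAt ∞ (T% X) x) :
    ∀ᶠ y in 𝓝 x, MDiffAt (T% X) y := by
  filter_upwards [(contMDiffAt_iff_contMDiffAt_nhds (by simp)).1 (hX.of_le (m := 1) (by simp))]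
    with y hy
  exact hy.mdifferentiableAt (by simp)

theorem ext_self (v : TangentSpace I x) : ext v x = v :=
  FiberBundle.extend_apply_self E v

theorem contMDiffAt_mlieBracket (hX : CMDiffAt ∞ (T% X) x) (hY : CMDiffAt ∞ (T% Y) x) :
    CMDiffAt ∞ (T% (mlieBracket I X Y)) x := by
  have : IsManifold I (((⊤ : ℕ∞) : ℕ∞ω) + 1) M := ‹IsManifold I ∞ M›
  have : IsManifold I (minSmoothness ℝ 2) M := by
    rw [minSmoothness_of_isRCLikeNormedField]; infer_instance
  exact ContMDiffAt.mlieBracket_vectorField (m := ⊤) (n := ⊤) hX hY (by simp)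

/-- Reduced to smoothness of Lie brackets: `df(X) W = [X, fW] - f [X, W]`. Pairing with a field `W`
that does not vanish at `x` and dividing by `h(W, W)` isolates `df(X)`. -/
theorem contMDiffAt_mvfderiv_apply (h : Metric I M) {f : M → ℝ} (hf : CMDiffAt ∞ f x)
    (hX : CMDiffAt ∞ (T% X) x) : CMDiffAt ∞ (fun y ↦ d% f y (X y)) x := by
  rcases subsingleton_or_nontrivial E with hE | hE
  · have h0 (y : M) : d% f y (X y) = 0 := by
      have : X y = 0 := Subsingleton.elim (α := E) _ _
      rw [this, map_zero]
    simpa only [h0] using contMDiffAt_const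
  obtain ⟨w, hw⟩ := exists_ne (0 : E)
  let w' : TangentSpace I x := w
  have hW : CMDiffAt ∞ (T% (ext w')) x := FiberBundle.contMDiffAt_extend I E w'
  have hWW := contMDiffAt_inner h hW hW
  have h0 : h.inner x (ext w' x) (ext w' x) ≠ 0 := by
    rw [ext_self]
    exact (h.pos x w' hw).ne'
  have h1 := contMDiffAt_inner h
    ((contMDiffAt_mlieBracket hX (hf.smul_section hW)).sub_section
      (hf.smul_section (contMDiffAt_mlieBracket hX hW))) hW
  refine (h1.div₀ hWW h0).congr_of_eventuallyEq ?_
  filter_upwards [hWW.continuousAt.eventually_ne h0, eventually_mdifferentiableAt hW,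
    (contMDiffAt_iff_contMDiffAt_nhds (by simp)).1 (hf.of_le (m := 1) (by simp))] with y hy hWy hfy
  have := mlieBracket_smul_right (V := X) (hfy.mdifferentiableAt (by simp)) hWy
  rw [eq_comm, Pi.div_apply, div_eq_iff hy, Pi.sub_apply, this, Pi.smul_apply',
    add_sub_cancel_right, map_smul, smul_apply, smul_eq_mul]

theorem contMDiffAt_koszul (h : Metric I M) (hX : CMDiffAt ∞ (T% X) x)
    (hY : CMDiffAt ∞ (T% Y) x) (hZ : CMDiffAt ∞ (T% Z) x) :
    CMDiffAt ∞ (fun y ↦ koszul h X Y Z y) x := by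
  have h1 := contMDiffAt_mvfderiv_apply h (contMDiffAt_inner h hY hZ) hX
  have h2 := contMDiffAt_mvfderiv_apply h (contMDiffAt_inner h hX hZ) hY
  have h3 := contMDiffAt_mvfderiv_apply h (contMDiffAt_inner h hX hY) hZ
  have h4 := contMDiffAt_inner h (contMDiffAt_mlieBracket hX hY) hZ
  have h5 := contMDiffAt_inner h (contMDiffAt_mlieBracket hX hZ) hY
  have h6 := contMDiffAt_inner h (contMDiffAt_mlieBracket hY hZ) hX
  exact contMDiffAt_const.mul (((((h1.add h2).sub h3).add h4).sub h5).sub h6)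

theorem contMDiffAt_leviCivita_apply [T2Space M] (h : Metric I M) (hX : CMDiffAt ∞ (T% X) x)
    (hY : CMDiffAt ∞ (T% Y) x) : CMDiffAt ∞ (T% (fun y ↦ leviCivita h Y y (X y))) x := by
  refine contMDiffAt_of_inner h fun Z hZ ↦ ?_
  refine (contMDiffAt_koszul h hX hY (hZ x)).congr_of_eventuallyEq ?_
  filter_upwards [eventually_mdifferentiableAt hX, eventually_mdifferentiableAt hY] with y hXy hYy
  exact inner_leviCivita h hXy hYy ((hZ y).mdifferentiableAt (by simp))

end Smooth

/-- A connection is smooth as soon as it maps smooth vector fields to smooth vector fields. -/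
theorem contMDiffCovariantDerivative_of_apply [T2Space M] (cov : AffineConnection I M)
    (hcov : ∀ X Y : Π y : M, TangentSpace I y, CMDiff ∞ (T% X) → CMDiff ∞ (T% Y) →
      CMDiff ∞ (T% (fun y ↦ cov Y y (X y)))) :
    CovariantDerivative.ContMDiffCovariantDerivative cov ∞ where
  contMDiff := {
    contMDiff := fun {Y} hY ↦ by
      rw [contMDiffOn_univ] at hY ⊢
      exact fun x ↦ contMDiffAt_hom_section fun X hX ↦ hcov X Y hX hY x }

theorem contMDiff_covariantDerivative_apply
    {cov : AffineConnection I M} (hcov : CovariantDerivative.ContMDiffCovariantDerivative cov ∞)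
    {X Y : Π y : M, TangentSpace I y} (hX : CMDiff ∞ (T% X)) (hY : CMDiff ∞ (T% Y)) :
    CMDiff ∞ (T% (fun y ↦ cov Y y (X y))) := by
  have h1 := hcov.contMDiff.contMDiff (σ := Y) (contMDiffOn_univ.2 hY)
  rw [contMDiffOn_univ] at h1
  exact fun x ↦ ContMDiffAt.clm_bundle_apply (h1 x) (hX x)

/-! ### Commutators, the Jacobi identity and locality -/

section Calculus

variable {x : M} {X Y Z : Π y : M, TangentSpace I y}

/-- The commutator of the derivations given by two vector fields is their Lie bracket. -/
theorem mvfderiv_mlieBracket (h : Metric I M) {f : M → ℝ} (hf : CMDiffAt ∞ f x)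
    (hX : CMDiffAt ∞ (T% X) x) (hY : CMDiffAt ∞ (T% Y) x) :
    d% f x (mlieBracket I X Y x) =
      d% (fun y ↦ d% f y (Y y)) x (X x) - d% (fun y ↦ d% f y (X y)) x (Y x) := by
  rcases subsingleton_or_nontrivial E with hE | hE
  · have h0 (v : TangentSpace I x) : v = 0 := Subsingleton.elim (α := E) _ _
    rw [h0 (mlieBracket I X Y x), h0 (X x), h0 (Y x)]
    simp
  obtain ⟨w, hw⟩ := exists_ne (0 : E)
  let w' : TangentSpace I x := w
  set W : Π y : M, TangentSpace I y := ext w'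
  have hW : CMDiffAt ∞ (T% W) x := FiberBundle.contMDiffAt_extend I E w'
  have hWx : W x ≠ 0 := by rwa [show W x = w' from ext_self w']
  have hfe : ∀ᶠ y in 𝓝 x, MDiffAt f y := by
    filter_upwards [(contMDiffAt_iff_contMDiffAt_nhds (by simp)).1 (hf.of_le (m := 1) (by simp))]
      with y hy using hy.mdifferentiableAt (by simp)
  have expand {U V : Π y : M, TangentSpace I y} (hU : CMDiffAt ∞ (T% U) x)
      (hV : CMDiffAt ∞ (T% V) x) : mlieBracket I U (mlieBracket I V (f • W)) x =
        d% (fun y ↦ d% f y (V y)) x (U x) • W x + d% f x (V x) • mlieBracket I U W x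
          + (d% f x (U x) • mlieBracket I V W x + f x • mlieBracket I U (mlieBracket I V W) x) := by
    have hdf := contMDiffAt_mvfderiv_apply h hf hV
    have hVW := contMDiffAt_mlieBracket hV hW
    have he : mlieBracket I V (f • W) =ᶠ[𝓝 x]
        (fun y ↦ d% f y (V y)) • W + f • mlieBracket I V W := by
      filter_upwards [hfe, eventually_mdifferentiableAt hW] with y hfy hWy
      exact mlieBracket_smul_right hfy hWy
    rw [(EventuallyEq.refl _ _).mlieBracket_vectorField_eq he,
      mlieBracket_add_right ((hdf.smul_section hW).mdifferentiableAt (by simp))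
        ((hf.smul_section hVW).mdifferentiableAt (by simp)),
      mlieBracket_smul_right (hdf.mdifferentiableAt (by simp)) (hW.mdifferentiableAt (by simp)),
      mlieBracket_smul_right hfe.self_of_nhds (hVW.mdifferentiableAt (by simp))]
  have : IsManifold I (minSmoothness ℝ 3) M := by
    rw [minSmoothness_of_isRCLikeNormedField]; infer_instance
  have h2 : minSmoothness ℝ 2 ≤ ∞ := by
    rw [minSmoothness_of_isRCLikeNormedField]; exact ENat.LEInfty.out
  -- The Jacobi identity for `X`, `Y`, `fW`, minus `f` times the one for `X`, `Y`, `W`, leaves the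
  -- claimed equation multiplied by `W x`, which is nonzero.
  have j1 := leibniz_identity_mlieBracket_apply (hX.of_le h2) (hY.of_le h2)
    ((hf.smul_section hW).of_le h2)
  have j2 := leibniz_identity_mlieBracket_apply (hX.of_le h2) (hY.of_le h2) (hW.of_le h2)
  rw [expand hX hY, expand hY hX, mlieBracket_smul_right hfe.self_of_nhds
    (hW.mdifferentiableAt (by simp)), j2] at j1
  refine smul_left_injective ℝ hWx ?_
  simp only
  rw [← sub_eq_zero] at j1 ⊢
  rw [← neg_eq_zero, ← j1]
  module

theorem jacobi_mlieBracket (hX : CMDiffAt ∞ (T% X) x) (hY : CMDiffAt ∞ (T% Y) x)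
    (hZ : CMDiffAt ∞ (T% Z) x) : mlieBracket I X (mlieBracket I Y Z) x
      + mlieBracket I Y (mlieBracket I Z X) x + mlieBracket I Z (mlieBracket I X Y) x = 0 := by
  have : IsManifold I (minSmoothness ℝ 3) M := by
    rw [minSmoothness_of_isRCLikeNormedField]; infer_instance
  have h2 : minSmoothness ℝ 2 ≤ ∞ := by
    rw [minSmoothness_of_isRCLikeNormedField]; exact ENat.LEInfty.out
  rw [leibniz_identity_mlieBracket_apply (hX.of_le h2) (hY.of_le h2) (hZ.of_le h2),
    mlieBracket_swap_apply (V := Z), mlieBracket_swap (V := Z) (W := X)]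
  have : mlieBracket I Y (-mlieBracket I X Z) x = -mlieBracket I Y (mlieBracket I X Z) x := by
    rw [show -mlieBracket I X Z = (-1 : ℝ) • mlieBracket I X Z by simp,
      mlieBracket_const_smul_right ((contMDiffAt_mlieBracket hX hZ).mdifferentiableAt (by simp))]
    simp
  rw [this]
  abel

theorem covariantDerivative_sub (cov : AffineConnection I M) (hX : MDiffAt (T% X) x)
    (hY : MDiffAt (T% Y) x) : cov (X - Y) x = cov X x - cov Y x := by
  have hXY : MDiffAt (T% (X - Y)) x := mdifferentiableAt_sub_section hX hY
  rw [eq_sub_iff_add_eq, ← cov.isCovariantDerivativeOnUniv.add hXY hY, sub_add_cancel]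

theorem covariantDerivative_congr (cov : AffineConnection I M) (hX : MDiffAt (T% X) x)
    (hXY : ∀ᶠ y in 𝓝 x, X y = Y y) : cov X x = cov Y x := by
  refine cov.isCovariantDerivativeOnUniv.congr_of_eventuallyEq hX
    (hX.congr_of_eventuallyEq ?_) univ_mem hXY
  filter_upwards [hXY] with y hy
  rw [hy]

theorem leviCivita_sub_swap (h : Metric I M) (hX : MDiffAt (T% X) x) (hY : MDiffAt (T% Y) x) :
    leviCivita h Y x (X x) - leviCivita h X x (Y x) = mlieBracket I X Y x :=
  (leviCivita h).torsion_eq_zero_iff.1 (leviCivita_torsion h) hX hY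

theorem mvfderiv_inner (h : Metric I M) (hX : MDiffAt (T% X) x) (hY : MDiffAt (T% Y) x)
    (u : TangentSpace I x) : d% (fun y ↦ h.inner y (X y) (Y y)) x u =
      h.inner x (leviCivita h X x u) (Y x) + h.inner x (X x) (leviCivita h Y x u) := by
  have := congr($(leviCivita_metric h hX hY) u)
  simp only [metricDeriv, sub_apply, ContinuousLinearMap.comp_apply, zero_apply] at this
  rw [h.symm x (leviCivita h X x u)]
  linear_combination this

theorem contMDiffAt_ext (v : TangentSpace I x) : CMDiffAt ∞ (T% (ext v)) x :=
  FiberBundle.contMDiffAt_extend I E v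

theorem mdifferentiableAt_ext (v : TangentSpace I x) : MDiffAt (T% (ext v)) x :=
  FiberBundle.mdifferentiableAt_extend I E v

end Calculus

/-! ### Symmetries of the Riemann tensor -/

section LeviCivitaCurvature

theorem curvature_swap (cov : AffineConnection I M) {x : M} (u v w : TangentSpace I x) :
    curvature cov x v u w = -curvature cov x u v w := by
  simp only [curvature, mlieBracket_swap_apply (V := ext v) (W := ext u), map_neg]
  abel

variable [T2Space M] (h : Metric I M) {x : M}

theorem mvfderiv_mvfderiv_inner {X Y Z : Π y : M, TangentSpace I y} (hX : CMDiffAt ∞ (T% X) x)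
    (hY : CMDiffAt ∞ (T% Y) x) (hZ : CMDiffAt ∞ (T% Z) x) (u : TangentSpace I x) :
    d% (fun y ↦ d% (fun y' ↦ h.inner y' (Y y') (Z y')) y (X y)) x u =
      h.inner x (leviCivita h (fun y ↦ leviCivita h Y y (X y)) x u) (Z x)
      + h.inner x (leviCivita h Y x (X x)) (leviCivita h Z x u)
      + (h.inner x (leviCivita h Y x u) (leviCivita h Z x (X x))
      + h.inner x (Y x) (leviCivita h (fun y ↦ leviCivita h Z y (X y)) x u)) := by
  have hDY := (contMDiffAt_leviCivita_apply h hX hY).mdifferentiableAt (by simp)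
  have hDZ := (contMDiffAt_leviCivita_apply h hX hZ).mdifferentiableAt (by simp)
  have hYx := hY.mdifferentiableAt (by simp)
  have hZx := hZ.mdifferentiableAt (by simp)
  have he : (fun y ↦ d% (fun y' ↦ h.inner y' (Y y') (Z y')) y (X y)) =ᶠ[𝓝 x] fun y ↦
      h.inner y (leviCivita h Y y (X y)) (Z y) + h.inner y (Y y) (leviCivita h Z y (X y)) := by
    filter_upwards [eventually_mdifferentiableAt hY, eventually_mdifferentiableAt hZ]
      with y hYy hZy using mvfderiv_inner h hYy hZy _
  rw [mvfderiv, he.mfderiv_eq]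
  change d% (fun y ↦ h.inner y (leviCivita h Y y (X y)) (Z y)
    + h.inner y (Y y) (leviCivita h Z y (X y))) x u = _
  rw [mvfderiv_fun_add (mdifferentiableAt_inner h hDY hZx) (mdifferentiableAt_inner h hYx hDZ),
    add_apply, mvfderiv_inner h hDY hZx, mvfderiv_inner h hYx hDZ]

/-- Apply `[U, V] f = U(V f) - V(U f)` to `f = h(W, Z)`. In the second derivatives the mixed terms
`h(D_V W, D_U Z) + h(D_U W, D_V Z)` are symmetric in `U`, `V` and cancel; what remains is the
antisymmetry. -/
theorem inner_curvature_leviCivita_swap (u v w z : TangentSpace I x) :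
    h.inner x (curvature (leviCivita h) x u v z) w
      = -h.inner x (curvature (leviCivita h) x u v w) z := by
  have hf := contMDiffAt_inner h (contMDiffAt_ext w) (contMDiffAt_ext z)
  have h1 := mvfderiv_mlieBracket h hf (contMDiffAt_ext u) (contMDiffAt_ext v)
  rw [mvfderiv_mvfderiv_inner h (contMDiffAt_ext v) (contMDiffAt_ext w) (contMDiffAt_ext z),
    mvfderiv_mvfderiv_inner h (contMDiffAt_ext u) (contMDiffAt_ext w) (contMDiffAt_ext z),
    mvfderiv_inner h (mdifferentiableAt_ext w) (mdifferentiableAt_ext z)] at h1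
  simp only [ext_self] at h1
  rw [h.symm x _ w]
  simp only [curvature, map_sub, sub_apply]
  linear_combination -h1

/-- Vanishing torsion, used twice, turns the terms of the cyclic sum into double Lie brackets, and
the Jacobi identity finishes. -/
theorem curvature_leviCivita_bianchi (u v w : TangentSpace I x) :
    curvature (leviCivita h) x u v w + curvature (leviCivita h) x v w u
      + curvature (leviCivita h) x w u v = 0 := by
  have key (u v w : TangentSpace I x) :
      leviCivita h (fun y ↦ leviCivita h (ext w) y (ext v y)) x u
        - leviCivita h (fun y ↦ leviCivita h (ext v) y (ext w y)) x u
        - leviCivita h (ext u) x (mlieBracket I (ext v) (ext w) x)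
      = mlieBracket I (ext u) (mlieBracket I (ext v) (ext w)) x := by
    have h1 := (contMDiffAt_leviCivita_apply h (contMDiffAt_ext v) (contMDiffAt_ext w))
    have h2 := (contMDiffAt_leviCivita_apply h (contMDiffAt_ext w) (contMDiffAt_ext v))
    have hb := contMDiffAt_mlieBracket (contMDiffAt_ext v) (contMDiffAt_ext w)
    rw [← leviCivita_sub_swap h (mdifferentiableAt_ext u) (hb.mdifferentiableAt (by simp)),
      ext_self, ← sub_apply, ← covariantDerivative_sub _ (h1.mdifferentiableAt (by simp))
        (h2.mdifferentiableAt (by simp))]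
    congr 2
    refine covariantDerivative_congr _
      ((h1.sub_section h2).mdifferentiableAt (by simp)) ?_
    filter_upwards [eventually_mdifferentiableAt (contMDiffAt_ext v),
      eventually_mdifferentiableAt (contMDiffAt_ext w)] with y hvy hwy
    exact leviCivita_sub_swap h hvy hwy
  rw [← jacobi_mlieBracket (contMDiffAt_ext u) (contMDiffAt_ext v) (contMDiffAt_ext w),
    ← key, ← key, ← key]
  simp only [curvature]
  abel

end LeviCivitaCurvature

/-! ### Connections `D + s ω` and their curvature -/

section CubicPerturbation

/-- A covariant three-tensor whose values on smooth vector fields are smooth. -/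
def IsSmoothCubic (om : CubicTensor I M) : Prop :=
  ∀ ⦃x : M⦄ ⦃X Y Z : Π y : M, TangentSpace I y⦄, CMDiffAt ∞ (T% X) x → CMDiffAt ∞ (T% Y) x →
    CMDiffAt ∞ (T% Z) x → CMDiffAt ∞ (fun y ↦ om y (X y) (Y y) (Z y)) x

set_option maxSynthPendingDepth 3 in
set_option synthInstance.maxHeartbeats 200000 in
theorem IsTraceFreeCubic.isSmoothCubic {h : Metric I M} {om : CubicTensor I M}
    (hom : IsTraceFreeCubic h om) : IsSmoothCubic om := by
  intro x X Y Z hX hY hZ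
  have h1 := ContMDiffAt.clm_bundle_apply (F₂ := E →L[ℝ] E →L[ℝ] ℝ)
    (E₂ := fun y : M ↦ TangentSpace I y →L[ℝ] TangentSpace I y →L[ℝ] ℝ) (hom.smooth x) hX
  have h2 := ContMDiffAt.clm_bundle_apply₂ (F₃ := ℝ) (E₃ := fun _ : M ↦ ℝ) h1 hY hZ
  simp only [contMDiffAt_totalSpace] at h2
  exact h2.2

set_option maxSynthPendingDepth 3 in
set_option synthInstance.maxHeartbeats 200000 in
/-- A covariant three-tensor is smooth as soon as its values on smooth vector fields are. -/
theorem contMDiff_of_apply [T2Space M] {om : CubicTensor I M}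
    (hom : ∀ X Y Z : Π y : M, TangentSpace I y, CMDiff ∞ (T% X) → CMDiff ∞ (T% Y) →
      CMDiff ∞ (T% Z) → CMDiff ∞ (fun y ↦ om y (X y) (Y y) (Z y))) :
    ContMDiff I (I.prod 𝓘(ℝ, E →L[ℝ] E →L[ℝ] E →L[ℝ] ℝ)) ∞
      (fun x ↦ TotalSpace.mk' (E →L[ℝ] E →L[ℝ] E →L[ℝ] ℝ)
        (E := fun x : M ↦
          TangentSpace I x →L[ℝ] TangentSpace I x →L[ℝ] TangentSpace I x →L[ℝ] ℝ) x (om x)) := by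
  intro x
  refine contMDiffAt_hom_section (F₂ := E →L[ℝ] E →L[ℝ] ℝ)
    (V₂ := fun y : M ↦ TangentSpace I y →L[ℝ] TangentSpace I y →L[ℝ] ℝ) fun X hX ↦ ?_
  refine contMDiffAt_hom_section (F₂ := E →L[ℝ] ℝ)
    (V₂ := fun y : M ↦ TangentSpace I y →L[ℝ] ℝ) fun Y hY ↦ ?_
  refine contMDiffAt_hom_section (F₂ := ℝ) (V₂ := fun _ : M ↦ ℝ) fun Z hZ ↦ ?_
  rw [contMDiffAt_section]
  exact hom X Y Z hX hY hZ x

/-- The connection is `D + s om_{ij}^k` on differentiable vector fields. -/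
def IsCubicPerturbation (h : Metric I M) (cov : AffineConnection I M) (om : CubicTensor I M)
    (s : ℝ) : Prop :=
  ∀ ⦃x : M⦄ ⦃Y : Π y : M, TangentSpace I y⦄, MDiffAt (T% Y) x → ∀ u : TangentSpace I x,
    cov Y x u = leviCivita h Y x u + s • cubicEndo h om x (Y x) u

theorem isCubicPerturbation_cubicConnection (h : Metric I M) (om : CubicTensor I M) (s : ℝ) :
    IsCubicPerturbation h (cubicConnection h om s) om s :=
  fun _ _ _ _ ↦ rfl

theorem isCubicPerturbation_differenceCubic (h : Metric I M) (cov : AffineConnection I M) :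
    IsCubicPerturbation h cov (differenceCubic h cov) 1 := by
  intro x Y hY u
  refine eq_of_inner_eq h fun w ↦ ?_
  rw [map_add, add_apply, one_smul, inner_cubicEndo, differenceCubic_apply h cov u w hY, map_sub,
    sub_apply, add_sub_cancel]

section

variable {h : Metric I M} {cov : AffineConnection I M} {om : CubicTensor I M} {s : ℝ} {x : M}

theorem IsCubicPerturbation.inner_apply (hc : IsCubicPerturbation h cov om s)
    {Y : Π y : M, TangentSpace I y} (hY : MDiffAt (T% Y) x) (u w : TangentSpace I x) :
    h.inner x (cov Y x u) w = h.inner x (leviCivita h Y x u) w + s * om x u (Y x) w := by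
  rw [hc hY, map_add, add_apply, map_smul, smul_apply, inner_cubicEndo, smul_eq_mul]

theorem IsCubicPerturbation.metricDeriv_apply (hc : IsCubicPerturbation h cov om s)
    {V W : Π y : M, TangentSpace I y} (hV : MDiffAt (T% V) x) (hW : MDiffAt (T% W) x)
    (u : TangentSpace I x) :
    metricDeriv h cov V W x u = -s * (om x u (V x) (W x) + om x u (W x) (V x)) := by
  simp only [metricDeriv, sub_apply, ContinuousLinearMap.comp_apply]
  rw [mvfderiv_inner h hV hW, h.symm x (W x), h.symm x (V x) (cov W x u), hc.inner_apply hV,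
    hc.inner_apply hW, h.symm x (V x)]
  ring

/-- For `ω` symmetric in its last two slots `∇h = -2sω`, so adding `∇h` replaces `s` by `s - 2s =
-s`. -/
theorem IsCubicPerturbation.conjugate (hc : IsCubicPerturbation h cov om s)
    (hom : ∀ (x : M) (u v w : TangentSpace I x), om x u v w = om x u w v) :
    IsCubicPerturbation h (conjugate h cov) om (-s) := by
  intro x Y hY u
  have h1 : ∑ i, metricDeriv h cov Y (ext (frame h x i)) x u • frame h x i =
      -(2 * s) • cubicEndo h om x (Y x) u := by
    conv_rhs => rw [← sum_inner_frame h x (cubicEndo h om x (Y x) u), Finset.smul_sum]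
    refine Finset.sum_congr rfl fun i _ ↦ ?_
    rw [hc.metricDeriv_apply hY (mdifferentiableAt_ext _), ext_self, inner_cubicEndo,
      hom x u (frame h x i), smul_smul]
    congr 1
    ring
  change (cov Y x + ∑ i, (metricDeriv h cov Y (ext (frame h x i)) x).smulRight (frame h x i)) u = _
  simp only [add_apply, sum_apply, ContinuousLinearMap.smulRight_apply, h1, hc hY]
  module

theorem contMDiffAt_cubicEndo [T2Space M] (h : Metric I M) (hom : IsSmoothCubic om)
    {X Y : Π y : M, TangentSpace I y} (hX : CMDiffAt ∞ (T% X) x) (hY : CMDiffAt ∞ (T% Y) x) :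
    CMDiffAt ∞ (T% (fun y ↦ cubicEndo h om y (Y y) (X y))) x := by
  refine contMDiffAt_of_inner h fun Z hZ ↦ ?_
  simp only [inner_cubicEndo]
  exact hom hX hY (hZ x)

theorem contMDiffCovariantDerivative_cubicConnection [T2Space M] (h : Metric I M)
    (hom : IsSmoothCubic om) (s : ℝ) :
    CovariantDerivative.ContMDiffCovariantDerivative (cubicConnection h om s) ∞ :=
  contMDiffCovariantDerivative_of_apply _ fun _ _ hX hY x ↦
    (contMDiffAt_leviCivita_apply h (hX x) (hY x)).add_section
      ((contMDiffAt_cubicEndo h hom (hX x) (hY x)).const_smul_section (a := s))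

theorem IsCubicPerturbation.inner_second_derivative [T2Space M]
    (hc : IsCubicPerturbation h cov om s) (hom : IsSmoothCubic om)
    (u v w z : TangentSpace I x) :
    h.inner x (cov (fun y ↦ cov (ext w) y (ext v y)) x u) z =
      h.inner x (leviCivita h (fun y ↦ leviCivita h (ext w) y (ext v y)) x u) z
      + s * (nablaCubic (leviCivita h) om x u v w z + om x (leviCivita h (ext v) x u) w z
        + om x v (leviCivita h (ext w) x u) z)
      + s * om x u (leviCivita h (ext w) x v) z
      + s ^ 2 * ∑ p, om x v w (frame h x p) * om x u (frame h x p) z := by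
  have hD := contMDiffAt_leviCivita_apply h (contMDiffAt_ext v) (contMDiffAt_ext w)
  have hA := contMDiffAt_cubicEndo h hom (contMDiffAt_ext v) (contMDiffAt_ext w)
  have hD' := hD.mdifferentiableAt (by simp)
  have hA' := hA.mdifferentiableAt (by simp)
  have hsA' := (hA.const_smul_section (a := s)).mdifferentiableAt (by simp)
  have hT := (hD.add_section (hA.const_smul_section (a := s))).mdifferentiableAt (by simp)
  have he : ∀ᶠ y in 𝓝 x,
      ((fun y ↦ leviCivita h (ext w) y (ext v y)) +
        s • fun y ↦ cubicEndo h om y (ext w y) (ext v y)) y = cov (ext w) y (ext v y) := by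
    filter_upwards [eventually_mdifferentiableAt (contMDiffAt_ext w)] with y hwy
    exact (hc hwy _).symm
  rw [← covariantDerivative_congr cov hT he, hc.inner_apply hT,
    (leviCivita h).isCovariantDerivativeOnUniv.add hD' hsA',
    (leviCivita h).isCovariantDerivativeOnUniv.smul_const s hA']
  -- Differentiating `ω(V, W, Z) = h(A(W)V, Z)`, with `A` the raised tensor, expresses the
  -- derivative of `A(W)V` through `Dω`.
  have h1 := mvfderiv_inner h hA' (mdifferentiableAt_ext z) u
  simp only [inner_cubicEndo, ext_self] at h1
  have h2 : om x u (cubicEndo h om x w v) z =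
      ∑ p, om x v w (frame h x p) * om x u (frame h x p) z := by
    conv_lhs => rw [← sum_inner_frame h x (cubicEndo h om x w v)]
    simp only [inner_cubicEndo, map_sum, map_smul, sum_apply, smul_apply, smul_eq_mul]
  simp only [add_apply, smul_apply, Pi.add_apply, Pi.smul_apply, map_add, map_smul, smul_eq_mul,
    ext_self, h2, nablaCubic]
  rw [h1]
  ring

set_option maxSynthPendingDepth 3 in
set_option synthInstance.maxHeartbeats 200000 in
-- On antisymmetrizing the second derivative in `u`, `v`, the terms `ω(v, D_u w, z) + ω(u, D_v w,
-- z)` cancel by symmetry, and `ω(D_u v - D_v u, w, z)` cancels the contribution of `∇_{[u,v]}`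
-- since `D` is torsion-free.
theorem IsCubicPerturbation.curvatureLow_eq [T2Space M] (hc : IsCubicPerturbation h cov om s)
    (hom : IsSmoothCubic om) (u v w z : TangentSpace I x) :
    curvatureLow h cov x u v w z = curvatureLow h (leviCivita h) x u v w z
      + s * (nablaCubic (leviCivita h) om x u v w z - nablaCubic (leviCivita h) om x v u w z)
      + s ^ 2 * ∑ p, (om x v w (frame h x p) * om x u (frame h x p) z
        - om x u w (frame h x p) * om x v (frame h x p) z) := by
  have h1 := leviCivita_sub_swap h (mdifferentiableAt_ext u) (mdifferentiableAt_ext v)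
  simp only [ext_self] at h1
  simp only [curvatureLow, curvature, map_sub, sub_apply, hc.inner_second_derivative hom,
    hc.inner_apply (mdifferentiableAt_ext w), ext_self, Finset.sum_sub_distrib]
  rw [← h1]
  simp only [map_sub, sub_apply]
  ring

end

end CubicPerturbation

/-! ### Jacobi's formula and the covariant derivative of `det h` -/

section Determinants

theorem mvfderiv_sum_mul {ι : Type*} (t : Finset ι) {f g : ι → M → ℝ} {x : M}
    (hf : ∀ i, MDiffAt (f i) x) (hg : ∀ i, MDiffAt (g i) x) (u : TangentSpace I x) :
    MDiffAt (fun y ↦ ∑ i ∈ t, f i y * g i y) x ∧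
      d% (fun y ↦ ∑ i ∈ t, f i y * g i y) x u =
        ∑ i ∈ t, (f i x * d% (g i) x u + d% (f i) x u * g i x) := by
  classical
  induction t using Finset.induction_on with
  | empty =>
    simp only [Finset.sum_empty, mvfderiv_const, zero_apply, and_true]
    exact mdifferentiableAt_const
  | insert a t ha ih =>
    simp only [Finset.sum_insert ha]
    have hm : MDiffAt (fun y ↦ f a y * g a y) x := (hf a).mul (hg a)
    refine ⟨hm.add ih.1, ?_⟩
    rw [mvfderiv_fun_add hm ih.1, add_apply, ih.2, mvfderiv_fun_mul (hf a) (hg a)]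
    simp [mul_comm]

theorem sum_det_updateRow {ι : Type*} [Fintype ι] [DecidableEq ι] (A B : Matrix ι ι ℝ) :
    ∑ i, (A.updateRow i (B i)).det = (A.adjugate * B).trace := by
  simp only [← Matrix.cramer_transpose_apply, Matrix.cramer_eq_adjugate_mulVec,
    ← Matrix.adjugate_transpose, Matrix.trace, Matrix.diag, Matrix.mul_apply, Matrix.mulVec,
    dotProduct, Matrix.transpose_apply]
  exact Finset.sum_comm

theorem sum_det_updateCol {ι : Type*} [Fintype ι] [DecidableEq ι] (A B : Matrix ι ι ℝ) :
    ∑ j, (A.updateCol j (fun i ↦ B i j)).det = (A.adjugate * B).trace := by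
  simp only [← Matrix.cramer_apply, Matrix.cramer_eq_adjugate_mulVec, Matrix.trace, Matrix.diag,
    Matrix.mul_apply, Matrix.mulVec, dotProduct]

/-- Jacobi's formula for the derivative of a determinant. -/
theorem mvfderiv_det {ι : Type*} [Fintype ι] [DecidableEq ι] {A : M → Matrix ι ι ℝ} {x : M}
    (hA : ∀ i j, CMDiffAt ∞ (fun y ↦ A y i j) x) (u : TangentSpace I x) :
    d% (fun y ↦ (A y).det) x u =
      ((A x).adjugate * Matrix.of fun i j ↦ d% (fun y ↦ A y i j) x u).trace := by
  let D : ContinuousMultilinearMap ℝ (fun _ : ι ↦ ι → ℝ) ℝ :=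
    ⟨(Matrix.detRowAlternating (n := ι) (R := ℝ)).toMultilinearMap,
      Continuous.matrix_det continuous_id⟩
  let A' : M → ι → ι → ℝ := A
  have hA' : MDifferentiableAt I 𝓘(ℝ, ι → ι → ℝ) A' x := ContMDiffAt.mdifferentiableAt (n := ∞)
    (contMDiffAt_pi_space.2 fun i ↦ contMDiffAt_pi_space.2 fun j ↦ hA i j) (by simp)
  have hentry (i j) : mvfderiv I A' x u i j = d% (fun y ↦ A y i j) x u := by
    let pr : (ι → ι → ℝ) →L[ℝ] ℝ :=
      (ContinuousLinearMap.proj (R := ℝ) (φ := fun _ : ι ↦ ℝ) j).comp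
        (ContinuousLinearMap.proj (R := ℝ) (φ := fun _ : ι ↦ ι → ℝ) i)
    have := mvfderiv_comp_apply (g := pr) x pr.mdifferentiableAt hA' u
    rw [show pr ∘ A' = fun y ↦ A y i j from rfl] at this
    rw [this]
    simp only [mvfderiv, mfderiv_eq_fderiv, pr.fderiv]
    rfl
  have h1 := mvfderiv_comp_apply (g := D) x (D.hasFDerivAt (A' x)).differentiableAt.mdifferentiableAt
    hA' u
  rw [show D ∘ A' = fun y ↦ (A y).det from rfl] at h1
  rw [h1, ← sum_det_updateRow]
  simp only [mvfderiv, mfderiv_eq_fderiv, (D.hasFDerivAt (A' x)).fderiv]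
  refine (ContinuousMultilinearMap.linearDeriv_apply _ _ _).trans ?_
  refine Finset.sum_congr rfl fun i _ ↦ ?_
  change Matrix.det _ = Matrix.det _
  congr 1
  ext k l
  by_cases hk : k = i
  · subst hk
    rw [Function.update_self, Matrix.updateRow_self]
    exact hentry k l
  · rw [Function.update_of_ne hk, Matrix.updateRow_ne hk]

/-- With `P`, `Q` the coordinate matrices of the two families (the second transposed) and `B` that
of `β` in the orthonormal frame, this is `tr(adj(PQ) P B Q) = det P · det Q · tr B`. Using the
adjugate rather than the inverse allows linearly dependent families. -/
theorem trace_adjugate_gram_mul (h : Metric I M) {x : M}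
    (β : TangentSpace I x →L[ℝ] TangentSpace I x →L[ℝ] ℝ)
    (v w : Fin (finrank ℝ E) → TangentSpace I x) :
    ((gram h v w).adjugate * Matrix.of fun i j ↦ β (v i) (w j)).trace =
      (gram h v (frame h x)).det * (gram h w (frame h x)).det *
        ∑ p, β (frame h x p) (frame h x p) := by
  have hβ : (Matrix.of fun i j ↦ β (v i) (w j)) = gram h v (frame h x) *
      ((Matrix.of fun i j ↦ β (frame h x i) (frame h x j)) *
        (gram h w (frame h x)).transpose) := by
    ext i j
    simp only [Matrix.of_apply]
    conv_lhs => rw [← sum_inner_frame h x (v i), ← sum_inner_frame h x (w j)]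
    simp only [map_sum, map_smul, sum_apply, smul_apply, smul_eq_mul, Matrix.mul_apply, gram,
      Matrix.of_apply, Matrix.transpose_apply]
    simp only [Finset.mul_sum]
    rw [Finset.sum_comm]
    exact Finset.sum_congr rfl fun a _ ↦ Finset.sum_congr rfl fun b _ ↦ by ring
  set P := gram h v (frame h x)
  set Q := (gram h w (frame h x)).transpose with hQ
  have hdet : (gram h w (frame h x)).det = Q.det := (Matrix.det_transpose _).symm
  rw [gram_mul, hβ, ← hQ, Matrix.adjugate_mul_distrib, Matrix.mul_assoc, ← Matrix.mul_assoc _ P,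
    Matrix.adjugate_mul, Matrix.smul_mul, Matrix.one_mul, Matrix.mul_smul, Matrix.trace_smul,
    Matrix.trace_mul_comm, Matrix.mul_assoc, Matrix.mul_adjugate, Matrix.mul_smul, Matrix.mul_one,
    Matrix.trace_smul, hdet, smul_eq_mul, smul_eq_mul, mul_assoc]
  rfl

/-- Each of the three Leibniz terms of `∇ det h` is a trace against the same adjugate: the first by
Jacobi's formula, the others by expanding along the altered row or column. -/
theorem nablaDet_eq_trace (h : Metric I M) (cov : AffineConnection I M) {x : M}
    (u : TangentSpace I x) (v w : Fin (finrank ℝ E) → TangentSpace I x) :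
    nablaDet h cov x u v w =
      ((gram h v w).adjugate * Matrix.of fun i j ↦ nablaMetric h cov x u (v i) (w j)).trace := by
  have h1 : d% (fun y ↦ detMetric h y (fun i ↦ ext (v i) y) (fun i ↦ ext (w i) y)) x u =
      ((gram h v w).adjugate * Matrix.of fun i j ↦
        d% (fun y ↦ h.inner y (ext (v i) y) (ext (w j) y)) x u).trace := by
    have := mvfderiv_det (A := fun y ↦ gram h (fun i ↦ ext (v i) y) (fun i ↦ ext (w i) y))
      (fun i j ↦ contMDiffAt_inner h (contMDiffAt_ext (v i)) (contMDiffAt_ext (w j))) u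
    simp only [ext_self] at this
    exact this
  have h2 : ∑ i, detMetric h x (Function.update v i (cov (ext (v i)) x u)) w =
      ((gram h v w).adjugate *
        Matrix.of fun i j ↦ h.inner x (cov (ext (v i)) x u) (w j)).trace := by
    rw [← sum_det_updateRow]
    refine Finset.sum_congr rfl fun i _ ↦ ?_
    rw [detMetric]
    congr 1
    ext k l
    by_cases hk : k = i
    · subst hk
      simp
    · simp [Matrix.updateRow_ne hk, Function.update_of_ne hk, gram]
  have h3 : ∑ i, detMetric h x v (Function.update w i (cov (ext (w i)) x u)) =
      ((gram h v w).adjugate *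
        Matrix.of fun i j ↦ h.inner x (v i) (cov (ext (w j)) x u)).trace := by
    rw [← sum_det_updateCol]
    refine Finset.sum_congr rfl fun j _ ↦ ?_
    rw [detMetric]
    congr 1
    ext k l
    by_cases hk : l = j
    · subst hk
      simp
    · simp [Matrix.updateCol_ne hk, Function.update_of_ne hk, gram]
  rw [nablaDet, h1, h2, h3, ← Matrix.trace_sub, ← Matrix.trace_sub, ← Matrix.mul_sub,
    ← Matrix.mul_sub]
  congr 2
  ext i j
  simp [nablaMetric, metricDeriv, h.symm x (w j)]

theorem IsCubicPerturbation.nablaMetric_eq {h : Metric I M} {cov : AffineConnection I M}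
    {om : CubicTensor I M} {s : ℝ} {x : M} (hc : IsCubicPerturbation h cov om s)
    (u v w : TangentSpace I x) :
    nablaMetric h cov x u v w = -s * (om x u v w + om x u w v) := by
  rw [nablaMetric, hc.metricDeriv_apply (mdifferentiableAt_ext v) (mdifferentiableAt_ext w)]
  simp only [ext_self]

theorem IsCubicPerturbation.nablaDet_eq {h : Metric I M} {cov : AffineConnection I M}
    {om : CubicTensor I M} {s : ℝ} {x : M} (hc : IsCubicPerturbation h cov om s)
    (hom : ∀ (x : M) (u v w : TangentSpace I x), om x u v w = om x u w v)
    (u : TangentSpace I x) (v w : Fin (finrank ℝ E) → TangentSpace I x) :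
    nablaDet h cov x u v w = -2 * s * ((gram h v (frame h x)).det * (gram h w (frame h x)).det *
        ∑ p, om x u (frame h x p) (frame h x p)) := by
  rw [nablaDet_eq_trace, ← trace_adjugate_gram_mul, ← smul_eq_mul (-2 * s), ← Matrix.trace_smul,
    ← Matrix.mul_smul (gram h v w).adjugate]
  congr 2
  ext i j
  simp only [hc.nablaMetric_eq, hom x u (w j), Matrix.of_apply, Matrix.smul_apply, smul_eq_mul]
  ring

end Determinants

/-! ### Traces of `Dω` -/

section TraceFree

variable {h : Metric I M} {om : CubicTensor I M} {x : M}

theorem nablaCubic_symm_left (cov : AffineConnection I M)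
    (hom : ∀ (x : M) (u v w : TangentSpace I x), om x u v w = om x v u w)
    (u v w z : TangentSpace I x) : nablaCubic cov om x u v w z = nablaCubic cov om x u w v z := by
  simp only [nablaCubic, fun y ↦ hom y (ext v y) (ext w y)]
  rw [hom x _ w, hom x v, hom x v w]
  ring

theorem nablaCubic_symm_right (cov : AffineConnection I M)
    (hom : ∀ (x : M) (u v w : TangentSpace I x), om x u v w = om x u w v)
    (u v w z : TangentSpace I x) : nablaCubic cov om x u v w z = nablaCubic cov om x u v z w := by
  simp only [nablaCubic, fun y ↦ hom y (ext v y) (ext w y)]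
  rw [hom x _ w, hom x v _ z, hom x v w]
  ring

/-- The covariant derivative of a trace-free symmetric tensor is trace-free. -/
theorem IsTraceFreeCubic.sum_nablaCubic (hom : IsTraceFreeCubic h om) (u v : TangentSpace I x) :
    ∑ p, nablaCubic (leviCivita h) om x u v (frame h x p) (frame h x p) = 0 := by
  set e := frame h x
  let G (y : M) := gram h (fun i ↦ ext (e i) y) (fun i ↦ ext (e i) y)
  let Ω (i j : Fin (finrank ℝ E)) (y : M) := om y (ext v y) (ext (e i) y) (ext (e j) y)
  have hGx : G x = 1 := by
    simp only [G, ext_self]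
    exact gram_frame h x
  have hG (i j) : CMDiffAt ∞ (fun y ↦ G y i j) x :=
    contMDiffAt_inner h (contMDiffAt_ext (e i)) (contMDiffAt_ext (e j))
  have hadj (i j) : MDiffAt (fun y ↦ (G y).adjugate i j) x :=
    (contMDiffAt_adjugate hG i j).mdifferentiableAt (by simp)
  have hG' (i j) : MDiffAt (fun y ↦ G y i j) x := (hG i j).mdifferentiableAt (by simp)
  have hΩ (i j) : MDiffAt (Ω i j) x := (hom.isSmoothCubic (contMDiffAt_ext v)
    (contMDiffAt_ext (e i)) (contMDiffAt_ext (e j))).mdifferentiableAt (by simp)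
  have hdG (i j) : d% (fun y ↦ G y i j) x u = h.inner x (leviCivita h (ext (e i)) x u) (e j)
      + h.inner x (e i) (leviCivita h (ext (e j)) x u) := by
    have := mvfderiv_inner h (mdifferentiableAt_ext (e i)) (mdifferentiableAt_ext (e j)) u
    simp only [ext_self] at this
    exact this
  -- Obtained by differentiating `adj G · G = det G · 1` at `x`, where `G = 1`.
  have hdadj (i j) : d% (fun y ↦ (G y).adjugate i j) x u =
      (if i = j then d% (fun y ↦ (G y).det) x u else 0) - d% (fun y ↦ G y i j) x u := by
    have h1 := (mvfderiv_sum_mul (I := I) Finset.univ (f := fun k y ↦ (G y).adjugate i k)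
      (g := fun k y ↦ G y k j) (fun k ↦ hadj i k) (fun k ↦ hG' k j) u).2
    have h2 (y) : ∑ k, (G y).adjugate i k * G y k j = if i = j then (G y).det else 0 := by
      rw [← Matrix.mul_apply, Matrix.adjugate_mul]
      simp [Matrix.one_apply]
    simp only [h2, hGx, Matrix.adjugate_one, Matrix.one_apply, ite_mul, one_mul, zero_mul,
      mul_ite, mul_one, mul_zero, Finset.sum_add_distrib, Finset.sum_ite_eq,
      Finset.sum_ite_eq', Finset.mem_univ, if_true] at h1
    rw [eq_sub_iff_add_eq, add_comm, ← h1]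
    split_ifs
    · rfl
    · rw [mvfderiv_const, zero_apply]
  -- The trace of `ω` in the extended frame, scaled by `det G`. It vanishes at every `y`, so it can
  -- be differentiated; the `d(det G)` term then multiplies a zero trace, and the `dG` terms supply
  -- the connection terms of `Dω`.
  have h0 (y) : ∑ q : Fin (finrank ℝ E) × Fin (finrank ℝ E),
      (G y).adjugate q.1 q.2 * Ω q.2 q.1 y = 0 := by
    rw [Fintype.sum_prod_type]
    have := trace_adjugate_gram_mul h (om y (ext v y)) (fun i ↦ ext (e i) y) (fun i ↦ ext (e i) y)
    rw [hom.trace_free y, mul_zero] at this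
    rw [← this]
    simp [Matrix.trace, Matrix.mul_apply, G, Ω]
  have h1 := (mvfderiv_sum_mul (I := I) Finset.univ
    (f := fun (q : Fin (finrank ℝ E) × Fin (finrank ℝ E)) y ↦ (G y).adjugate q.1 q.2)
    (g := fun q ↦ Ω q.2 q.1) (fun q ↦ hadj _ _) (fun q ↦ hΩ _ _) u).2
  simp only [h0, mvfderiv_const, zero_apply, hGx, Matrix.adjugate_one, Matrix.one_apply, hdadj,
    hdG, Fintype.sum_prod_type, Finset.sum_add_distrib, sub_mul, add_mul, ite_mul, one_mul,
    zero_mul, Finset.sum_sub_distrib, Finset.sum_ite_eq, Finset.mem_univ, if_true] at h1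
  have hΩx (i j) : Ω i j x = om x v (e i) (e j) := by simp only [Ω, ext_self]
  have htr : ∑ i, Ω i i x = 0 := by
    simp only [hΩx]
    exact hom.trace_free x v
  have hsum (w : TangentSpace I x) (i) :
      ∑ j, h.inner x w (e j) * Ω j i x = om x v w (e i) := by
    conv_rhs => rw [← sum_inner_frame h x w]
    simp only [hΩx, map_sum, map_smul, sum_apply, smul_apply, smul_eq_mul, e]
  have h2 : ∑ i, ∑ j, h.inner x (e i) (leviCivita h (ext (e j)) x u) * Ω j i x =
      ∑ i, om x v (leviCivita h (ext (e i)) x u) (e i) := by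
    rw [Finset.sum_comm]
    refine Finset.sum_congr rfl fun j _ ↦ ?_
    rw [← hsum]
    refine Finset.sum_congr rfl fun i _ ↦ ?_
    rw [h.symm, hΩx, hΩx, hom.symm_right]
  rw [← Finset.mul_sum, htr, mul_zero, h2] at h1
  simp only [hsum] at h1
  simp only [nablaCubic, Finset.sum_sub_distrib, e, hom.trace_free,
    fun i ↦ hom.symm_right x v (frame h x i) (leviCivita h (ext (frame h x i)) x u)]
  change ∑ i, d% (Ω i i) x u - 0 - _ - _ = 0
  linarith

/-- The Codazzi equation makes `Dω` totally symmetric, so the contraction with the derivative index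
equals a trace over two tensor slots. -/
theorem IsTraceFreeCubic.divergence_eq_zero (hom : IsTraceFreeCubic h om) (hcod : IsCodazzi h om)
    (v w : TangentSpace I x) : divergence h om x v w = 0 := by
  rw [← hom.sum_nablaCubic v w, divergence]
  refine Finset.sum_congr rfl fun p _ ↦ ?_
  rw [nablaCubic_symm_left _ hom.symm_left, hcod, nablaCubic_symm_right _ hom.symm_right,
    nablaCubic_symm_left _ hom.symm_left]

end TraceFree

/-! ### Ricci traces and the coupled system -/

section CoupledSystem

theorem ricci_eq_sum (h : Metric I M) (cov : AffineConnection I M) {x : M}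
    (v w : TangentSpace I x) :
    ricci h cov x v w = ∑ p, curvatureLow h cov x (frame h x p) v w (frame h x p) := by
  simp only [ricci, curvatureLow, frame_coord]

theorem curvature_eq_iff_curvatureLow_eq (h : Metric I M) (cov cov' : AffineConnection I M)
    {x : M} (u v w : TangentSpace I x) : curvature cov x u v w = curvature cov' x u v w ↔
      ∀ z, curvatureLow h cov x u v w z = curvatureLow h cov' x u v w z :=
  ⟨fun H z ↦ by rw [curvatureLow, H, curvatureLow], fun H ↦ eq_of_inner_eq h H⟩

theorem sum_inner_frame_self (h : Metric I M) (x : M) :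
    ∑ p, h.inner x (frame h x p) (frame h x p) = (finrank ℝ E : ℝ) := by
  simp [inner_frame]

variable {h : Metric I M} {om : CubicTensor I M} {x : M}

/-- The remaining products in the contraction contain the trace `ω_{pp}{}^q` and sum to zero. -/
theorem IsTraceFreeCubic.cubicRicci_eq (hom : IsTraceFreeCubic h om) (v w : TangentSpace I x) :
    cubicRicci h om x v w =
      ∑ p, ∑ q, om x v (frame h x p) (frame h x q) * om x w (frame h x q) (frame h x p) := by
  have h1 (q) : ∑ p, om x (frame h x p) (frame h x p) (frame h x q) = 0 := by
    rw [← hom.trace_free x (frame h x q)]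
    refine Finset.sum_congr rfl fun p _ ↦ ?_
    rw [hom.symm_right, hom.symm_left]
  have h2 : ∑ p, ∑ q, om x w v (frame h x q) * om x (frame h x p) (frame h x p) (frame h x q)
      = 0 := by
    rw [Finset.sum_comm]
    simp only [← Finset.mul_sum, h1, mul_zero, Finset.sum_const_zero]
  have h3 : cubicRicci h om x v w = ∑ p, ∑ q,
      (om x v (frame h x p) (frame h x q) * om x w (frame h x q) (frame h x p)
        - om x w v (frame h x q) * om x (frame h x p) (frame h x p) (frame h x q)) := by
    refine Finset.sum_congr rfl fun p _ ↦ Finset.sum_congr rfl fun q _ ↦ ?_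
    rw [hom.symm_left x (frame h x p) w, hom.symm_left x (frame h x p) v, hom.symm_left x v w,
      hom.symm_right x w (frame h x q)]
    ring
  rw [h3]
  simp only [Finset.sum_sub_distrib]
  rw [h2, sub_zero]

theorem IsTraceFreeCubic.sum_cubicRicci (hom : IsTraceFreeCubic h om) :
    ∑ p, cubicRicci h om x (frame h x p) (frame h x p) = normSq h om x := by
  simp only [hom.cubicRicci_eq, normSq]
  refine Finset.sum_congr rfl fun p _ ↦ Finset.sum_congr rfl fun q _ ↦
    Finset.sum_congr rfl fun r _ ↦ ?_
  rw [hom.symm_right x _ (frame h x r), sq]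

/-- The trace-reversed form of the Einstein equation of the coupled system. -/
theorem IsTraceFreeCubic.einstein_iff (hom : IsTraceFreeCubic h om) (hn : 2 < finrank ℝ E)
    (κ : ℝ) :
    (∀ v w : TangentSpace I x,
      ricci h (leviCivita h) x v w - (1 / 2) * scalar h (leviCivita h) x * h.inner x v w
        + ((finrank ℝ E : ℝ) - 2) / (2 * (finrank ℝ E : ℝ)) * κ * h.inner x v w
      = 1 * (cubicRicci h om x v w - (1 / 2) * normSq h om x * h.inner x v w)) ↔
    ∀ v w : TangentSpace I x, ricci h (leviCivita h) x v w - cubicRicci h om x v w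
      = κ / (finrank ℝ E : ℝ) * h.inner x v w := by
  have hn' : (2 : ℝ) < (finrank ℝ E : ℝ) := by exact_mod_cast hn
  have hn0 : (finrank ℝ E : ℝ) ≠ 0 := by positivity
  have hcoef : ((finrank ℝ E : ℝ) - 2) / (2 * (finrank ℝ E : ℝ)) * κ
      = κ / 2 - κ / (finrank ℝ E : ℝ) := by
    field_simp
  constructor
  · intro H
    have htr := Finset.sum_congr (rfl : (Finset.univ : Finset (Fin (finrank ℝ E))) = Finset.univ)
      fun p _ ↦ H (frame h x p) (frame h x p)
    simp only [Finset.sum_add_distrib, Finset.sum_sub_distrib, ← Finset.mul_sum,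
      sum_inner_frame_self, hom.sum_cubicRicci] at htr
    rw [show ∑ p, ricci h (leviCivita h) x (frame h x p) (frame h x p)
      = scalar h (leviCivita h) x from rfl, hcoef] at htr
    have hκ : scalar h (leviCivita h) x - normSq h om x = κ := by
      -- Tracing the Einstein equation gives this multiple of `R_h - |ω|² - κ`; since `n > 2` the
      -- scalar identity follows, and substituting it back undoes the trace reversal.
      have h1 : ((finrank ℝ E : ℝ) - 2)
          * (scalar h (leviCivita h) x - normSq h om x - κ) = 0 := by
        have h2 : κ / (finrank ℝ E : ℝ) * (finrank ℝ E : ℝ) = κ := div_mul_cancel₀ _ hn0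
        linear_combination -2 * htr - 2 * h2
      rcases mul_eq_zero.1 h1 with h1 | h1 <;> linarith
    intro v w
    have := H v w
    rw [hcoef] at this
    linear_combination this + (1 / 2) * h.inner x v w * hκ
  · intro H v w
    have htr := Finset.sum_congr (rfl : (Finset.univ : Finset (Fin (finrank ℝ E))) = Finset.univ)
      fun p _ ↦ H (frame h x p) (frame h x p)
    simp only [Finset.sum_sub_distrib, ← Finset.mul_sum, sum_inner_frame_self,
      hom.sum_cubicRicci, div_mul_cancel₀ _ hn0] at htr
    rw [show ∑ p, ricci h (leviCivita h) x (frame h x p) (frame h x p)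
      = scalar h (leviCivita h) x from rfl] at htr
    rw [hcoef]
    linear_combination H v w - (1 / 2) * h.inner x v w * htr

variable {cov : AffineConnection I M} {s : ℝ}

/-- The Codazzi equation kills the term linear in `s`, so the result is the same for `s = 1` and `s
= -1`. -/
theorem IsCubicPerturbation.curvatureLow_of_isCodazzi [T2Space M]
    (hc : IsCubicPerturbation h cov om s) (hs : s ^ 2 = 1) (hom : IsTraceFreeCubic h om)
    (hcod : IsCodazzi h om) (u v w z : TangentSpace I x) :
    curvatureLow h cov x u v w z = curvatureLow h (leviCivita h) x u v w z
      + ∑ p, (om x (frame h x p) z u * om x v w (frame h x p)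
        - om x (frame h x p) z v * om x u w (frame h x p)) := by
  rw [hc.curvatureLow_eq hom.isSmoothCubic, hcod, sub_self, mul_zero, add_zero, hs, one_mul]
  congr 1
  refine Finset.sum_congr rfl fun p _ ↦ ?_
  rw [hom.symm_right x (frame h x p) z, hom.symm_left x (frame h x p) u,
    hom.symm_right x (frame h x p) z, hom.symm_left x (frame h x p) v]
  ring

theorem IsCubicPerturbation.ricci_of_isCodazzi [T2Space M]
    (hc : IsCubicPerturbation h cov om s) (hs : s ^ 2 = 1) (hom : IsTraceFreeCubic h om)
    (hcod : IsCodazzi h om) (v w : TangentSpace I x) :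
    ricci h cov x v w = ricci h (leviCivita h) x v w - cubicRicci h om x v w := by
  have h1 : ∑ q, ∑ p, om x (frame h x p) (frame h x q) (frame h x q) * om x v w (frame h x p)
      = 0 := by
    rw [Finset.sum_comm]
    simp only [← Finset.sum_mul, hom.trace_free, zero_mul, Finset.sum_const_zero]
  simp only [ricci_eq_sum, hc.curvatureLow_of_isCodazzi hs hom hcod, Finset.sum_add_distrib,
    Finset.sum_sub_distrib, hom.cubicRicci_eq]
  rw [h1, zero_sub, ← sub_eq_add_neg]
  congr 1
  refine Finset.sum_congr rfl fun q _ ↦ Finset.sum_congr rfl fun p _ ↦ ?_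
  rw [hom.symm_right x _ _ v, hom.symm_left x _ v, hom.symm_left x _ w,
    hom.symm_right x v (frame h x p), hom.symm_right x w (frame h x p)]

/-- The Riemann tensor has these symmetries. In the quadratic part, swapping the last two arguments
exchanges the two products, and the cyclic sum cancels in pairs by symmetry of `ω`. -/
theorem IsCubicPerturbation.isMetricCurvatureType [T2Space M]
    (hc : IsCubicPerturbation h cov om s) (hs : s ^ 2 = 1) (hom : IsTraceFreeCubic h om)
    (hcod : IsCodazzi h om) : IsMetricCurvatureType (curvatureLow h cov x) where
  antisymm_left u v w z := by
    simp only [curvatureLow]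
    rw [curvature_swap, map_neg, neg_apply]
  antisymm_right u v w z := by
    have h1 : curvatureLow h (leviCivita h) x u v z w = -curvatureLow h (leviCivita h) x u v w z :=
      inner_curvature_leviCivita_swap h u v w z
    rw [hc.curvatureLow_of_isCodazzi hs hom hcod, hc.curvatureLow_of_isCodazzi hs hom hcod, h1,
      neg_add, ← Finset.sum_neg_distrib]
    congr 1
    refine Finset.sum_congr rfl fun p _ ↦ ?_
    rw [hom.symm_left x _ w u, hom.symm_right x w _ u, hom.symm_left x w u,
      hom.symm_left x _ w v, hom.symm_right x w _ v, hom.symm_left x w v,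
      hom.symm_left x _ z u, hom.symm_right x z _ u, hom.symm_left x z u,
      hom.symm_left x _ z v, hom.symm_right x z _ v, hom.symm_left x z v]
    ring
  bianchi u v w z := by
    have h1 := congr(h.inner x $(curvature_leviCivita_bianchi h u v w) z)
    simp only [map_add, add_apply, map_zero, zero_apply] at h1
    simp only [hc.curvatureLow_of_isCodazzi hs hom hcod]
    have h2 : ∑ p, (om x (frame h x p) z u * om x v w (frame h x p)
          - om x (frame h x p) z v * om x u w (frame h x p))
        + ∑ p, (om x (frame h x p) z v * om x w u (frame h x p)
          - om x (frame h x p) z w * om x v u (frame h x p))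
        + ∑ p, (om x (frame h x p) z w * om x u v (frame h x p)
          - om x (frame h x p) z u * om x w v (frame h x p)) = 0 := by
      rw [← Finset.sum_add_distrib, ← Finset.sum_add_distrib]
      refine Finset.sum_eq_zero fun p _ ↦ ?_
      rw [hom.symm_left x w u, hom.symm_left x v u, hom.symm_left x w v]
      ring
    simp only [curvatureLow]
    linear_combination h1 + h2

theorem IsCubicPerturbation.torsion_eq_zero (hc : IsCubicPerturbation h cov om s)
    (hom : ∀ (x : M) (u v w : TangentSpace I x), om x u v w = om x v u w) : cov.torsion = 0 := by
  rw [CovariantDerivative.torsion_eq_zero_iff]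
  intro X Y x hX hY
  rw [← leviCivita_sub_swap h hX hY, hc hX, hc hY]
  have : cubicEndo h om x (Y x) (X x) = cubicEndo h om x (X x) (Y x) :=
    eq_of_inner_eq h fun w ↦ by rw [inner_cubicEndo, inner_cubicEndo, hom]
  rw [this]
  abel

theorem IsCubicPerturbation.symm_left_of_torsion_eq_zero (hc : IsCubicPerturbation h cov om 1)
    (ht : cov.torsion = 0) (u v w : TangentSpace I x) : om x u v w = om x v u w := by
  have h1 := cov.torsion_eq_zero_iff.1 ht (mdifferentiableAt_ext u) (mdifferentiableAt_ext v)
  rw [← leviCivita_sub_swap h (mdifferentiableAt_ext u) (mdifferentiableAt_ext v),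
    hc (mdifferentiableAt_ext u), hc (mdifferentiableAt_ext v)] at h1
  simp only [ext_self, one_smul] at h1
  rw [← inner_cubicEndo h, ← inner_cubicEndo h]
  congr 2
  rw [← sub_eq_zero] at h1 ⊢
  rw [← h1]
  abel

theorem isTraceFreeCubic_differenceCubic [T2Space M]
    (hcov : CovariantDerivative.ContMDiffCovariantDerivative cov ∞) (ht : cov.torsion = 0)
    (hm : IsMetricCodazzi h cov) (hd : IsDetParallel h cov) :
    IsTraceFreeCubic h (differenceCubic h cov) := by
  have hc := isCubicPerturbation_differenceCubic h cov
  have hleft (x : M) (u v w : TangentSpace I x) :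
      differenceCubic h cov x u v w = differenceCubic h cov x v u w :=
    hc.symm_left_of_torsion_eq_zero ht u v w
  have hright (x : M) (u v w : TangentSpace I x) :
      differenceCubic h cov x u v w = differenceCubic h cov x u w v := by
    -- As `∇_u h(v, w) = -(ω(u,v,w) + ω(u,w,v))`, symmetry in the first two slots removes one term
    -- from each side; the surviving equality is symmetry in the last two.
    have h1 := hm x w v u
    rw [hc.nablaMetric_eq, hc.nablaMetric_eq, hleft x w v] at h1
    rw [hleft x u v, hleft x u w]
    linarith
  refine ⟨contMDiff_of_apply fun X Y Z hX hY hZ x ↦ ?_, hleft, hright, fun x u ↦ ?_⟩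
  · have h1 : ∀ y, differenceCubic h cov y (X y) (Y y) (Z y) =
        h.inner y (((fun y ↦ cov Y y (X y)) - fun y ↦ leviCivita h Y y (X y)) y) (Z y) :=
      fun y ↦ differenceCubic_apply h cov _ _ ((hY y).mdifferentiableAt (by simp))
    simp only [h1]
    exact contMDiffAt_inner h ((contMDiff_covariantDerivative_apply hcov hX hY x).sub_section
      (contMDiffAt_leviCivita_apply h (hX x) (hY x))) (hZ x)
  · have h1 := hd x u (frame h x) (frame h x)
    rw [hc.nablaDet_eq hright, gram_frame, Matrix.det_one] at h1
    linarith

/-- The connection and its conjugate correspond to `s = 1` and `s = -1`, so their curvatures differ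
by twice the linear term. -/
theorem isCodazzi_differenceCubic [T2Space M] (hom : IsTraceFreeCubic h (differenceCubic h cov))
    (hself : IsSelfConjugate h cov) : IsCodazzi h (differenceCubic h cov) := by
  intro x u v w z
  have hc := isCubicPerturbation_differenceCubic h cov
  have h1 := (curvature_eq_iff_curvatureLow_eq h _ _ u v w).1 (hself x u v w) z
  rw [hc.curvatureLow_eq hom.isSmoothCubic,
    (hc.conjugate hom.symm_right).curvatureLow_eq hom.isSmoothCubic] at h1
  linarith

theorem IsTraceFreeCubic.conservation (hom : IsTraceFreeCubic h om) (hcod : IsCodazzi h om)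
    (u : TangentSpace I x) : 0 = -2 * (finrank ℝ E : ℝ) * codazziForm h om x u
      + ((finrank ℝ E : ℝ) - 2) * divergenceForm h om x u := by
  have h1 (v w z : TangentSpace I x) : codazziOp h om x u v w z = 0 := by
    simp only [codazziOp, hom.divergence_eq_zero hcod]
    rw [hcod]
    ring
  simp [codazziForm, divergenceForm, h1, hom.divergence_eq_zero hcod]

end CoupledSystem

end EinsteinCubic

end

/-! ### The correspondence in both directions -/

theorem mainTheorem6
    {E : Type*} [NormedAddCommGroup E] [NormedSpace ℝ E] [FiniteDimensional ℝ E]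
    {H : Type*} [TopologicalSpace H] {I : ModelWithCorners ℝ E H} [I.Boundaryless]
    {M : Type*} [TopologicalSpace M] [T2Space M] [SecondCountableTopology M] [ConnectedSpace M]
    [ChartedSpace H M] [IsManifold I ∞ M]
    (n : ℕ) (hdim : Module.finrank ℝ E = n) (hn : 2 < n)
    (h : EinsteinCubic.Metric I M) :
    -- from solutions of the coupled system to connections
    (∀ (om : EinsteinCubic.CubicTensor I M) (κ : ℝ),
      EinsteinCubic.IsTraceFreeCubic h om →
      EinsteinCubic.IsCodazzi h om →
      EinsteinCubic.SolvesCoupledSystem h om κ 1 →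
      (∀ s : ℝ, s = 1 ∨ s = -1 →
        CovariantDerivative.ContMDiffCovariantDerivative
          (EinsteinCubic.cubicConnection h om s) ∞ ∧
        (EinsteinCubic.cubicConnection h om s).torsion = 0 ∧
        EinsteinCubic.IsMetricCodazzi h (EinsteinCubic.cubicConnection h om s) ∧
        EinsteinCubic.IsDetParallel h (EinsteinCubic.cubicConnection h om s) ∧
        (∀ (x : M) (u v w z : TangentSpace I x),
          EinsteinCubic.curvatureLow h (EinsteinCubic.cubicConnection h om s) x u v w z =
            EinsteinCubic.curvatureLow h (EinsteinCubic.leviCivita h) x u v w z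
              + ∑ p, (om x (EinsteinCubic.frame h x p) z u * om x v w (EinsteinCubic.frame h x p)
                - om x (EinsteinCubic.frame h x p) z v * om x u w (EinsteinCubic.frame h x p))) ∧
        (∀ x : M, EinsteinCubic.IsMetricCurvatureType
          (EinsteinCubic.curvatureLow h (EinsteinCubic.cubicConnection h om s) x)) ∧
        (∀ (x : M) (v w : TangentSpace I x),
          EinsteinCubic.ricci h (EinsteinCubic.cubicConnection h om s) x v w =
            EinsteinCubic.ricci h (EinsteinCubic.leviCivita h) x v w
              - ∑ p, ∑ q, om x v (EinsteinCubic.frame h x p) (EinsteinCubic.frame h x q)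
                * om x w (EinsteinCubic.frame h x q) (EinsteinCubic.frame h x p) ∧
          EinsteinCubic.ricci h (EinsteinCubic.cubicConnection h om s) x v w =
            κ / (n : ℝ) * h.inner x v w) ∧
        (∀ x : M,
          EinsteinCubic.scalar h (EinsteinCubic.cubicConnection h om s) x =
            EinsteinCubic.scalar h (EinsteinCubic.leviCivita h) x
              - EinsteinCubic.normSq h om x ∧
          EinsteinCubic.scalar h (EinsteinCubic.cubicConnection h om s) x = κ)) ∧
      (∀ (x : M) (u v w : TangentSpace I x),
        EinsteinCubic.curvature (EinsteinCubic.cubicConnection h om 1) x u v w =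
          EinsteinCubic.curvature (EinsteinCubic.cubicConnection h om (-1)) x u v w)) ∧
    -- from connections to solutions of the coupled system
    (∀ (nab : EinsteinCubic.AffineConnection I M) (κ : ℝ),
      CovariantDerivative.ContMDiffCovariantDerivative nab ∞ →
      nab.torsion = 0 →
      EinsteinCubic.IsMetricCodazzi h nab →
      EinsteinCubic.IsDetParallel h nab →
      EinsteinCubic.IsSelfConjugate h nab →
      (∀ (x : M) (v w : TangentSpace I x),
        EinsteinCubic.ricci h nab x v w = κ / (n : ℝ) * h.inner x v w) →
      EinsteinCubic.IsTraceFreeCubic h (EinsteinCubic.differenceCubic h nab) ∧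
      EinsteinCubic.IsCodazzi h (EinsteinCubic.differenceCubic h nab) ∧
      (∀ x : M, κ = EinsteinCubic.scalar h (EinsteinCubic.leviCivita h) x
        - EinsteinCubic.normSq h (EinsteinCubic.differenceCubic h nab) x) ∧
      EinsteinCubic.SolvesCoupledSystem h (EinsteinCubic.differenceCubic h nab) κ 1) := by
  subst hdim
  refine ⟨fun om κ hom hcod hsol ↦ ⟨fun s hs ↦ ?_, fun x u v w ↦ ?_⟩,
    fun nab κ hnab ht hm hd hself hric ↦ ?_⟩
  · have hs2 : s ^ 2 = 1 := by rcases hs with rfl | rfl <;> norm_num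
    have hc := EinsteinCubic.isCubicPerturbation_cubicConnection h om s
    have hric (x : M) (v w : TangentSpace I x) :
        EinsteinCubic.ricci h (EinsteinCubic.cubicConnection h om s) x v w =
          κ / (Module.finrank ℝ E : ℝ) * h.inner x v w := by
      rw [hc.ricci_of_isCodazzi hs2 hom hcod]
      exact (hom.einstein_iff hn κ).1 (hsol.einstein x) v w
    have hn0 : (Module.finrank ℝ E : ℝ) ≠ 0 := Nat.cast_ne_zero.2 (by omega)
    refine ⟨EinsteinCubic.contMDiffCovariantDerivative_cubicConnection h hom.isSmoothCubic s,
      hc.torsion_eq_zero hom.symm_left, fun x u v w ↦ ?_, fun x u v w ↦ ?_,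
      fun x ↦ hc.curvatureLow_of_isCodazzi hs2 hom hcod,
      fun x ↦ hc.isMetricCurvatureType hs2 hom hcod, fun x v w ↦ ⟨?_, hric x v w⟩,
      fun x ↦ ⟨?_, ?_⟩⟩
    · rw [hc.nablaMetric_eq, hc.nablaMetric_eq, hom.symm_left x u v, hom.symm_right x u w,
        hom.symm_left x u v, hom.symm_right x v w]
    · rw [hc.nablaDet_eq hom.symm_right, hom.trace_free, mul_zero, mul_zero]
    · rw [hc.ricci_of_isCodazzi hs2 hom hcod, hom.cubicRicci_eq]
    · simp only [EinsteinCubic.scalar, hc.ricci_of_isCodazzi hs2 hom hcod,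
        Finset.sum_sub_distrib, hom.sum_cubicRicci]
    · simp only [EinsteinCubic.scalar, hric, ← Finset.mul_sum,
        EinsteinCubic.sum_inner_frame_self, div_mul_cancel₀ _ hn0]
  · refine (EinsteinCubic.curvature_eq_iff_curvatureLow_eq h _ _ u v w).2 fun z ↦ ?_
    rw [(EinsteinCubic.isCubicPerturbation_cubicConnection h om 1).curvatureLow_of_isCodazzi
        (by norm_num) hom hcod,
      (EinsteinCubic.isCubicPerturbation_cubicConnection h om (-1)).curvatureLow_of_isCodazzi
        (by norm_num) hom hcod]
  · have hom := EinsteinCubic.isTraceFreeCubic_differenceCubic hnab ht hm hd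
    have hcod := EinsteinCubic.isCodazzi_differenceCubic hom hself
    have hc := EinsteinCubic.isCubicPerturbation_differenceCubic h nab
    have hn0 : (Module.finrank ℝ E : ℝ) ≠ 0 := Nat.cast_ne_zero.2 (by omega)
    have hric' (x : M) (v w : TangentSpace I x) := hric x v w
    simp only [hc.ricci_of_isCodazzi (one_pow 2) hom hcod] at hric'
    refine ⟨hom, hcod, fun x ↦ ?_, fun x u ↦ hom.conservation hcod u,
      fun x ↦ (hom.einstein_iff hn κ).2 (hric' x)⟩
    -- Tracing `Ric(D) - ρ(ω) = (κ/n) h` gives `R_h - |ω|² = κ`.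
    have htr := Finset.sum_congr
      (rfl : (Finset.univ : Finset (Fin (Module.finrank ℝ E))) = Finset.univ)
      fun p _ ↦ hric' x (EinsteinCubic.frame h x p) (EinsteinCubic.frame h x p)
    simp only [Finset.sum_sub_distrib, ← Finset.mul_sum, EinsteinCubic.sum_inner_frame_self,
      hom.sum_cubicRicci, div_mul_cancel₀ _ hn0] at htr
    exact htr.symm
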